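/- Let $\Lambda$ be a Nakayama algebra, i.e. an artin algebra (an algebra that is a finitely generated module over a commutative artinian ring) all of whose indecomposable projective left modules and indecomposable projective right modules are uniserial, and assume that no simple $\Lambda$-module is projective. Modules are left $\Lambda$-modules of finite length. A module $M$ is *Gorenstein projective* if there is an exact complex $P_\bullet=(P_i,\delta_i)_{i\in\mathbb Z}$ of (finitely generated) projective modules such that $\operatorname{Hom}_\Lambda(P_\bullet,\Lambda)$ is exact as well and $M\cong\operatorname{Im}(\delta_0)$. Let $\operatorname{gp}_0\Lambda$ be the class of Gorenstein projective modules without indecomposable projective direct summands, and let the *Gorenstein core* $\mathcal C(\Lambda)$ be the class of all finite direct sums of modules each of which is an indecomposable non-projective Gorenstein projective module or the projective cover of such a module. For a class $\mathcal M$ of modules let $\mathcal F(\mathcal M)$ be the class of modules having a finite filtration with all factors in $\mathcal M$. Let $\mathcal E=\mathcal E(\Lambda)$ be the class of non-zero modules in $\operatorname{gp}_0\Lambda$ such that no proper non-zero factor module is Gorenstein projective. (a) $\mathcal C(\Lambda)=\mathcal F(\mathcal E)$. (b) If $\Lambda$ is connected and $\mathcal C(\Lambda)\neq 0$, then $\mathcal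 E$ has only finitely many isomorphism classes, and if $E_1,\dots,E_g$ are representatives of them (one for each class), then every simple $\Lambda$-module occurs with multiplicity exactly $1$ as a composition factor of $\bigoplus_{i=1}^g E_i$. Moreover, $E_1,\dots,E_g$ are pairwise orthogonal bricks: every $\operatorname{End}_\Lambda(E_i)$ is a division ring, and $\operatorname{Hom}_\Lambda(E_i,E_j)=0$ for $i\neq j$. (c) Let $\mathcal E'$ be the class of non-zero modules in $\operatorname{gp}_0\Lambda$ such that no proper non-zero submodule is Gorenstein projective. Then $\mathcal E=\mathcal E'$. -/

import Mathlib

universe u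

open CategoryTheory
open scoped DirectSum

namespace NakayamaGP

section Modules

variable (Λ : Type u) [Ring Λ]

section Unbundled

variable (M : Type u) [AddCommGroup M] [Module Λ M]

/-- A module is uniserial if its submodules form a chain. -/
def IsUniserial : Prop :=
  ∀ U V : Submodule Λ M, U ≤ V ∨ V ≤ U

/-- A non-zero module which is not the direct sum of two non-zero submodules. -/
def IsIndecomposable : Prop :=
  Nontrivial M ∧ ∀ U V : Submodule Λ M, IsCompl U V → U = ⊥ ∨ V = ⊥

/-- A module is Gorenstein projective if it is isomorphic to the image of a differential in a
complete projective resolution: an exact `ℤ`-indexed complex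
`⋯ → P (i + 1) → P i → P (i - 1) → ⋯` of finitely generated projective modules, with
differentials `d i : P (i + 1) → P i`, which stays exact under `Hom(-, Λ)`. -/
def IsGorensteinProjective : Prop :=
  ∃ (P : ℤ → ModuleCat.{u} Λ) (d : ∀ i, P (i + 1) →ₗ[Λ] P i),
    (∀ i, Module.Finite Λ (P i) ∧ Module.Projective Λ (P i)) ∧
    (∀ i, Function.Exact (d (i + 1)) (d i)) ∧
    (∀ i, Function.Exact
      (fun φ : P i →ₗ[Λ] Λ => φ ∘ₗ d i)
      (fun φ : P (i + 1) →ₗ[Λ] Λ => φ ∘ₗ d (i + 1))) ∧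
    Nonempty (M ≃ₗ[Λ] LinearMap.range (d 0))

/-- No direct summand of `M` is indecomposable projective. -/
def HasNoProjectiveSummand : Prop :=
  ∀ U V : Submodule Λ M, IsCompl U V → IsIndecomposable Λ U → ¬ Module.Projective Λ U

/-- A brick: a module whose endomorphism ring is a division ring. -/
def IsBrick : Prop :=
  Nontrivial M ∧ ∀ f : M →ₗ[Λ] M, f ≠ 0 → Function.Bijective f

end Unbundled

/-- `P` is a projective cover of `M`: `P` is projective and there is a surjection `P → M`
whose kernel is superfluous. -/
def IsProjectiveCover (P M : Type u) [AddCommGroup P] [Module Λ P] [AddCommGroup M]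
    [Module Λ M] : Prop :=
  Module.Projective Λ P ∧ ∃ π : P →ₗ[Λ] M, Function.Surjective π ∧
    ∀ U : Submodule Λ P, U ⊔ LinearMap.ker π = ⊤ → U = ⊤

/-- The simple module `S` occurs with multiplicity `n` as a composition factor of `M`
(by the Jordan–Hölder theorem, the choice of the composition series does not matter). -/
def HasMultiplicity (S M : Type u) [AddCommGroup S] [Module Λ S] [AddCommGroup M]
    [Module Λ M] (n : ℕ) : Prop :=
  ∃ s : CompositionSeries (Submodule Λ M), s.head = ⊥ ∧ s.last = ⊤ ∧
    Nat.card {i : Fin s.length //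
      Nonempty ((s i.succ ⧸ (s i.castSucc).submoduleOf (s i.succ)) ≃ₗ[Λ] S)} = n

/-- All indecomposable projective left modules of finite length are uniserial. -/
def IsLeftSerial : Prop :=
  ∀ (P : Type u) [AddCommGroup P] [Module Λ P], IsFiniteLength Λ P →
    Module.Projective Λ P → IsIndecomposable Λ P → IsUniserial Λ P

/-- The Nakayama condition (for an artin algebra): the indecomposable projective left modules
and the indecomposable projective right modules are uniserial. -/
def IsNakayama : Prop :=
  IsLeftSerial Λ ∧ IsLeftSerial Λᵐᵒᵖ

/-- A connected ring: non-zero, with no central idempotents except `0` and `1`. -/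
def IsConnectedRing : Prop :=
  Nontrivial Λ ∧ ∀ e ∈ Set.center Λ, IsIdempotentElem e → e = 0 ∨ e = 1

/-- The class of the Gorenstein projective modules without indecomposable projective direct
summands. -/
def gpZero : ObjectProperty (ModuleCat.{u} Λ) := fun M =>
  IsGorensteinProjective Λ M ∧ HasNoProjectiveSummand Λ M

/-- The indecomposable non-projective Gorenstein projective modules. -/
def gpIndec : ObjectProperty (ModuleCat.{u} Λ) := fun M =>
  IsIndecomposable Λ M ∧ ¬ Module.Projective Λ M ∧ IsGorensteinProjective Λ M

/-- The Gorenstein core: the finite direct sums of indecomposable non-projective Gorenstein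
projective modules and of projective covers of such modules. -/
def core : ObjectProperty (ModuleCat.{u} Λ) := fun M =>
  ∃ (n : ℕ) (X : Fin n → ModuleCat.{u} Λ),
    (∀ i, gpIndec Λ (X i) ∨ ∃ N : ModuleCat.{u} Λ, gpIndec Λ N ∧ IsProjectiveCover Λ (X i) N) ∧
    Nonempty (M ≃ₗ[Λ] ⨁ i, X i)

/-- The non-zero modules in `gpZero` such that no proper non-zero factor module is Gorenstein
projective. -/
def elementary : ObjectProperty (ModuleCat.{u} Λ) := fun M =>
  gpZero Λ M ∧ Nontrivial M ∧
    ∀ U : Submodule Λ M, U ≠ ⊥ → U ≠ ⊤ → ¬ IsGorensteinProjective Λ (M ⧸ U)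

/-- The non-zero modules in `gpZero` such that no proper non-zero submodule is Gorenstein
projective. -/
def elementaryDual : ObjectProperty (ModuleCat.{u} Λ) := fun M =>
  gpZero Λ M ∧ Nontrivial M ∧
    ∀ U : Submodule Λ M, U ≠ ⊥ → U ≠ ⊤ → ¬ IsGorensteinProjective Λ U

variable {Λ}

/-- The class of all modules with a finite filtration `0 = F 0 ≤ F 1 ≤ ⋯ ≤ F t = M` all of whose
factors `F (i + 1) / F i` belong to `𝓜`. -/
def filtered (𝓜 : ObjectProperty (ModuleCat.{u} Λ)) : ObjectProperty (ModuleCat.{u} Λ) :=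
  fun M => ∃ (t : ℕ) (F : ℕ → Submodule Λ M), F 0 = ⊥ ∧ F t = ⊤ ∧
    ∀ i < t, F i ≤ F (i + 1) ∧
      𝓜 (ModuleCat.of Λ (F (i + 1) ⧸ (F i).submoduleOf (F (i + 1))))

/-- `E 0, …, E (g - 1)` are representatives of the isomorphism classes in `𝓜`, each class being
represented exactly once. -/
def IsSystemOfRepresentatives (𝓜 : ObjectProperty (ModuleCat.{u} Λ)) {g : ℕ}
    (E : Fin g → ModuleCat.{u} Λ) : Prop :=
  (∀ i, 𝓜 (E i)) ∧ (∀ i j, Nonempty (E i ≃ₗ[Λ] E j) → i = j) ∧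
    ∀ M : ModuleCat.{u} Λ, 𝓜 M → ∃ i, Nonempty (M ≃ₗ[Λ] E i)

end Modules

end NakayamaGP

set_option linter.unusedSectionVars false

/-! Everything is reduced to combinatorics of one permutation. Let `P i` run through the
indecomposable projectives, `c i` be the length of `P i`, and let `P (tau i)` be the projective
cover of the radical of `P i`. Right uniseriality makes `tau` injective, hence a permutation of a
finite set. Every finitely generated module is a direct sum of uniserial ones. A uniserial module is
determined by its type `(i, l)`, with top indexed by `i` and length `l ≤ c i`; its composition
factors have indices `i, tau i, …, tau^(l-1) i`, and its syzygy has type `(tau^l i, c i - l)`.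

Call `i` a Gorenstein vertex if `P i` covers a non-projective uniserial Gorenstein projective
module. The key fact is that for `l < c i` the type `(i, l)` is Gorenstein projective if and only if
both `i` and `tau^l i` are vertices. Necessity is closure under syzygies. For sufficiency, a vertex
satisfies `c i ≤ c (tau i)`, which makes inclusions of non-zero submodules of `P i` left
approximations by projectives; and `i ↦ tau^(c i) i`, the effect of two syzygies, maps the vertices
onto the vertices. So a pair of vertices propagates in both directions to a complete resolution.
Direct summands of images in complete resolutions are used in between, because closure of Gorenstein
projectivity under summands is not part of the definition.

Hence the elementary modules are the types `(i, m)` with `i` a vertex and `m > 0` minimal such that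
`tau^m i` is a vertex. This condition is the same seen from factor modules or from submodules, which
gives (c). For (a), a type whose two ends are vertices is cut at the intermediate vertices into
elementary pieces; conversely the tops and socles of a filtered module come from those of elementary
modules, so both ends of each uniserial summand are vertices. For (b), connectedness makes `tau` a
single cycle, and the vertices cut it into disjoint segments, one for each elementary module. The
image of a non-zero map between elementary modules would start at a vertex inside a segment unless
the map is bijective. -/

namespace NakayamaGP

/-! ### Primitive idempotents of artinian rings. -/

section Idempotents

variable {R : Type u} [Ring R]

/-- A primitive idempotent: a non-zero idempotent which is not the sum of two non-zero orthogonal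
idempotents. -/
structure IsPrimitiveIdempotent (e : R) : Prop where
  ne_zero : e ≠ 0
  idem : e * e = e
  eq_zero_or : ∀ f g : R, f + g = e → f * f = f → g * g = g → f * g = 0 → g * f = 0 →
    f = 0 ∨ g = 0

theorem IsPrimitiveIdempotent.op {e : R} (he : IsPrimitiveIdempotent e) :
    IsPrimitiveIdempotent (MulOpposite.op e) where
  ne_zero h := he.ne_zero (MulOpposite.op_injective h)
  idem := by rw [← MulOpposite.op_mul, he.idem]
  eq_zero_or f g hfg hf hg h₁ h₂ := by
    have := he.eq_zero_or f.unop g.unop (by rw [← MulOpposite.unop_add, hfg]; rfl)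
      (by rw [← MulOpposite.unop_mul, hf]) (by rw [← MulOpposite.unop_mul, hg])
      (by rw [← MulOpposite.unop_mul, h₂]; rfl) (by rw [← MulOpposite.unop_mul, h₁]; rfl)
    simpa using this

theorem mul_eq_of_mem_span {e : R} (he : e * e = e) {x : R} (hx : x ∈ Submodule.span R {e}) :
    x * e = x := by
  obtain ⟨a, rfl⟩ := Submodule.mem_span_singleton.1 hx
  rw [smul_eq_mul, mul_assoc, he]

theorem mem_span_of_mul_eq {e x : R} (hx : x * e = x) : x ∈ Submodule.span R {e} :=
  Submodule.mem_span_singleton.2 ⟨x, hx⟩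

/-- The linear map `Λ e → M` which sends `x` to `x • m`. -/
def spanMap {M : Type*} [AddCommGroup M] [Module R M] (e : R) (m : M) :
    Submodule.span R {e} →ₗ[R] M :=
  (LinearMap.toSpanSingleton R M m) ∘ₗ (Submodule.span R {e}).subtype

/-- The linear map `Λ → Λ e` given by right multiplication by `e`. -/
def mulSpan (e : R) : R →ₗ[R] Submodule.span R {e} :=
  LinearMap.toSpanSingleton R _ ⟨e, Submodule.mem_span_singleton_self e⟩

theorem projective_span_of_idem {e : R} (he : e * e = e) :
    Module.Projective R (Submodule.span R {e}) := by
  refine Module.Projective.of_split (Submodule.span R {e}).subtype (mulSpan e) ?_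
  ext x
  exact mul_eq_of_mem_span he x.2

/-- Splitting `e = u + v` along a decomposition gives orthogonal idempotents: `u * v = u - u * u`
lies in both summands, so it vanishes. Primitivity kills `u` or `v`, and then one summand contains
the generator `e`. -/
theorem IsPrimitiveIdempotent.isIndecomposable {e : R} (he : IsPrimitiveIdempotent e) :
    IsIndecomposable R (Submodule.span R {e}) := by
  have hmem := Submodule.mem_span_singleton_self (R := R) e
  refine ⟨⟨⟨⟨e, hmem⟩, 0, fun h => he.ne_zero (congrArg Subtype.val h)⟩⟩, fun U V hUV => ?_⟩
  obtain ⟨u, hu, v, hv, huv⟩ := Submodule.mem_sup.1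
    (show (⟨e, hmem⟩ : Submodule.span R {e}) ∈ U ⊔ V by rw [hUV.sup_eq_top]; trivial)
  have huv' : (u : R) + v = e := congrArg Subtype.val huv
  have key : ∀ (U V : Submodule R (Submodule.span R {e})) (u v : Submodule.span R {e}),
      Disjoint U V → u ∈ U → v ∈ V → (u : R) + v = e →
      (u : R) * u = u ∧ (u : R) * v = 0 := by
    intro U V u v hd hu hv h
    have h1 : (u : R) = u * u + u * v := by
      rw [← mul_add, h, mul_eq_of_mem_span he.idem u.2]
    have h2 : (u : R) • v = u - (u : R) • u := by
      ext
      simp only [Submodule.coe_smul, Submodule.coe_sub, smul_eq_mul]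
      nth_rewrite 2 [h1]
      abel
    have h3 : (u : R) • v = 0 := by
      refine Submodule.disjoint_def.1 hd _ ?_ (V.smul_mem _ hv)
      rw [h2]
      exact U.sub_mem hu (U.smul_mem _ hu)
    have h4 : (u : R) * v = 0 := congrArg Subtype.val h3
    refine ⟨?_, h4⟩
    rw [h4, add_zero] at h1
    exact h1.symm
  obtain ⟨a1, a2⟩ := key U V u v hUV.disjoint hu hv huv'
  obtain ⟨b1, b2⟩ := key V U v u hUV.disjoint.symm hv hu (by rw [add_comm, huv'])
  have top_of : ∀ (V : Submodule R (Submodule.span R {e})),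
      (⟨e, hmem⟩ : Submodule.span R {e}) ∈ V → V = ⊤ := by
    intro V h
    refine eq_top_iff.2 fun x _ => ?_
    have : x = (x : R) • (⟨e, hmem⟩ : Submodule.span R {e}) := by
      ext
      exact (mul_eq_of_mem_span he.idem x.2).symm
    rw [this]
    exact V.smul_mem _ h
  rcases he.eq_zero_or u v huv' a1 b1 a2 b2 with h | h
  · left
    have : V = ⊤ := top_of V (by
      rw [← huv, show u = 0 from Subtype.ext h, zero_add]; exact hv)
    exact (disjoint_top.1 (this ▸ hUV.disjoint))
  · right
    have : U = ⊤ := top_of U (by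
      rw [← huv, show v = 0 from Subtype.ext h, add_zero]; exact hu)
    exact (top_disjoint.1 (this ▸ hUV.disjoint))

theorem isFiniteLength_of_finite [IsArtinianRing R] {M : Type*} [AddCommGroup M] [Module R M]
    [Module.Finite R M] : IsFiniteLength R M :=
  isFiniteLength_iff_isNoetherian_isArtinian.2 ⟨inferInstance, inferInstance⟩

theorem IsPrimitiveIdempotent.isUniserial [IsArtinianRing R] (hR : IsLeftSerial R) {e : R}
    (he : IsPrimitiveIdempotent e) : IsUniserial R (Submodule.span R {e}) :=
  hR _ isFiniteLength_of_finite (projective_span_of_idem he.idem) he.isIndecomposable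

/-- Uniseriality of the right module `eR`, transported from the opposite ring and phrased as
divisibility in `R`. -/
theorem IsPrimitiveIdempotent.right_comparable [IsArtinianRing Rᵐᵒᵖ] (hR : IsLeftSerial Rᵐᵒᵖ)
    {e x y : R} (he : IsPrimitiveIdempotent e) (hx : e * x = x) (hy : e * y = y) :
    (∃ s, y = x * s) ∨ ∃ s, x = y * s := by
  have hx' : MulOpposite.op x ∈ Submodule.span Rᵐᵒᵖ {MulOpposite.op e} :=
    mem_span_of_mul_eq (by rw [← MulOpposite.op_mul, hx])
  have hy' : MulOpposite.op y ∈ Submodule.span Rᵐᵒᵖ {MulOpposite.op e} :=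
    mem_span_of_mul_eq (by rw [← MulOpposite.op_mul, hy])
  have aux : ∀ z w : Submodule.span Rᵐᵒᵖ {MulOpposite.op e},
      Submodule.span Rᵐᵒᵖ {z} ≤ Submodule.span Rᵐᵒᵖ {w} →
      ∃ s, (z : Rᵐᵒᵖ).unop = (w : Rᵐᵒᵖ).unop * s := by
    intro z w h
    obtain ⟨s, hs⟩ := Submodule.mem_span_singleton.1 (h (Submodule.mem_span_singleton_self z))
    refine ⟨s.unop, ?_⟩
    rw [← hs]
    rfl
  rcases he.op.isUniserial hR (Submodule.span _ {⟨_, hx'⟩}) (Submodule.span _ {⟨_, hy'⟩}) with h | h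
  · exact Or.inr (aux _ _ h)
  · exact Or.inl (aux _ _ h)

/-- Every idempotent of an artinian ring is a finite sum of orthogonal primitive idempotents. -/
theorem exists_sum_primitive [IsArtinianRing R] (f : R) (hf : f * f = f) :
    ∃ (ι : Type) (_ : Fintype ι) (e : ι → R), (∀ a, IsPrimitiveIdempotent (e a)) ∧
      (∀ a b, a ≠ b → e a * e b = 0) ∧ ∑ a, e a = f := by
  induction hI : Submodule.span R {f} using
    (inferInstance : WellFoundedLT (Submodule R R)).induction generalizing f with
  | ind J ih =>
  subst hI
  by_cases h0 : f = 0
  · exact ⟨Empty, inferInstance, Empty.elim, fun a => a.elim, fun a => a.elim, by simp [h0]⟩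
  by_cases hp : IsPrimitiveIdempotent f
  · exact ⟨Unit, inferInstance, fun _ => f, fun _ => hp, fun a b h => (h rfl).elim, by simp⟩
  have : ∃ g h : R, g + h = f ∧ g * g = g ∧ h * h = h ∧ g * h = 0 ∧ h * g = 0 ∧ g ≠ 0 ∧ h ≠ 0 := by
    by_contra hcon
    refine hp ⟨h0, hf, fun g h h1 h2 h3 h4 h5 => ?_⟩
    by_contra h6
    push Not at h6
    exact hcon ⟨g, h, h1, h2, h3, h4, h5, h6⟩
  obtain ⟨g, h, rfl, hg, hh, hgh, hhg, hg0, hh0⟩ := this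
  -- Right multiplication by `h` kills `R g` but not `g + h`, so the left ideals shrink strictly and
  -- the induction terminates.
  have lt_of : ∀ g h : R, g * g = g → h * h = h → g * h = 0 → h ≠ 0 →
      Submodule.span R {g} < Submodule.span R {g + h} := by
    intro g h hg hh hgh hh0
    refine lt_of_le_of_ne ?_ ?_
    · rw [Submodule.span_singleton_le_iff_mem]
      exact Submodule.mem_span_singleton.2 ⟨g, by simp [mul_add, hg, hgh]⟩
    · intro heq
      obtain ⟨r, hr⟩ := Submodule.mem_span_singleton.1
        (heq ▸ Submodule.mem_span_singleton_self (g + h) : g + h ∈ Submodule.span R {g})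
      have h1 : (g + h) * h = 0 := by rw [← hr, smul_eq_mul, mul_assoc, hgh, mul_zero]
      rw [add_mul, hgh, hh, zero_add] at h1
      exact hh0 h1
  obtain ⟨ι, i1, e, p1, o1, s1⟩ := ih _ (lt_of g h hg hh hgh hh0) g hg rfl
  obtain ⟨κ, i2, e', p2, o2, s2⟩ := ih _ (add_comm h g ▸ lt_of h g hh hg hhg hg0) h hh rfl
  have left : ∀ a, e a * g = e a ∧ g * e a = e a := by
    intro a
    rw [← s1, Finset.mul_sum, Finset.sum_mul]
    constructor <;>
    · rw [Finset.sum_eq_single a]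
      · exact (p1 a).idem
      · intro b _ hb
        first | exact o1 _ _ hb | exact o1 _ _ hb.symm
      · simp
  have right : ∀ a, e' a * h = e' a ∧ h * e' a = e' a := by
    intro a
    rw [← s2, Finset.mul_sum, Finset.sum_mul]
    constructor <;>
    · rw [Finset.sum_eq_single a]
      · exact (p2 a).idem
      · intro b _ hb
        first | exact o2 _ _ hb | exact o2 _ _ hb.symm
      · simp
  refine ⟨ι ⊕ κ, inferInstance, Sum.elim e e', ?_, ?_, by simp [s1, s2]⟩
  · rintro (a | a)
    exacts [p1 a, p2 a]
  · rintro (a | a) (b | b) hab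
    · exact o1 a b fun h => hab (by rw [h])
    · change e a * e' b = 0
      rw [← (left a).1, ← (right b).2, mul_assoc, ← mul_assoc g, hgh, zero_mul, mul_zero]
    · change e' a * e b = 0
      rw [← (right a).1, ← (left b).2, mul_assoc, ← mul_assoc h, hhg, zero_mul, mul_zero]
    · exact o2 a b fun h => hab (by rw [h])

end Idempotents

/-! ### The frame of indecomposable projectives. -/

/-- Representatives `P i` of the indecomposable projective left modules of a serial ring `Λ`
without simple projective modules, together with a decomposition of `Λ` into copies of them. The
field `comparable` records the uniseriality of the indecomposable projective right modules. -/
structure SerialFrame (Λ : Type u) [Ring Λ] where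
  I : Type
  finite : Finite I
  P : I → Submodule Λ Λ
  nontrivial : ∀ i, Nontrivial (P i)
  uniserial : ∀ i, IsUniserial Λ (P i)
  projective : ∀ i, Module.Projective Λ (P i)
  not_simple : ∀ i, ¬ IsSimpleModule Λ (P i)
  eq_of_equiv : ∀ i j, Nonempty (P i ≃ₗ[Λ] P j) → i = j
  comparable : ∀ (j a b : I) (φ : P j →ₗ[Λ] P a) (ψ : P j →ₗ[Λ] P b),
    (∃ s : P a →ₗ[Λ] P b, ψ = s ∘ₗ φ) ∨ (∃ s : P b →ₗ[Λ] P a, φ = s ∘ₗ ψ)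
  ι : Type
  fintype : Fintype ι
  cl : ι → I
  cl_surjective : Function.Surjective cl
  inc : ∀ a, P (cl a) →ₗ[Λ] Λ
  proj : ∀ a, Λ →ₗ[Λ] P (cl a)
  proj_inc_self : ∀ a, proj a ∘ₗ inc a = LinearMap.id
  proj_inc_of_ne : ∀ a b, a ≠ b → proj a ∘ₗ inc b = 0
  sum_inc_proj : ∑ a, inc a ∘ₗ proj a = LinearMap.id

attribute [instance] SerialFrame.finite SerialFrame.nontrivial SerialFrame.projective
  SerialFrame.fintype

/-- Maps `Λ e → Λ f` are right multiplications by elements of `e Λ f`. Comparing two maps out of the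
same projective therefore amounts to comparing two elements of `e Λ` under right divisibility, which
is where right uniseriality enters. -/
theorem exists_serialFrame {Λ : Type u} [Ring Λ] [IsArtinianRing Λ] [IsArtinianRing Λᵐᵒᵖ]
    (hΛ : IsNakayama Λ)
    (hsimple : ∀ (S : Type u) [AddCommGroup S] [Module Λ S],
      IsSimpleModule Λ S → ¬ Module.Projective Λ S) : Nonempty (SerialFrame Λ) := by
  classical
  obtain ⟨ι, hι, e, hp, ho, hs⟩ := exists_sum_primitive (1 : Λ) (one_mul 1)
  let P : ι → Submodule Λ Λ := fun a => Submodule.span Λ {e a}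
  let st : Setoid ι :=
    { r := fun a b => Nonempty (P a ≃ₗ[Λ] P b)
      iseqv := ⟨fun a => ⟨LinearEquiv.refl _ _⟩, fun ⟨h⟩ => ⟨h.symm⟩,
        fun ⟨h⟩ ⟨h'⟩ => ⟨h.trans h'⟩⟩ }
  have hout : ∀ a : ι, Nonempty (P (Quotient.mk st a).out ≃ₗ[Λ] P a) := fun a =>
    Quotient.exact (Quotient.out_eq (Quotient.mk st a))
  let E : ∀ a : ι, P (Quotient.mk st a).out ≃ₗ[Λ] P a := fun a => (hout a).some
  have hmem : ∀ a, e a ∈ P a := fun a => Submodule.mem_span_singleton_self (e a)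
  have happ : ∀ (a b : ι) (φ : P a →ₗ[Λ] P b) (z : P a),
      (φ z : Λ) = (z : Λ) * (φ ⟨e a, hmem a⟩ : Λ) := by
    intro a b φ z
    have : z = (z : Λ) • (⟨e a, hmem a⟩ : P a) := by
      ext
      exact (mul_eq_of_mem_span (hp a).idem z.2).symm
    conv_lhs => rw [this, map_smul]
    rfl
  have hcomp : ∀ (j a b : ι) (φ : P j →ₗ[Λ] P a) (ψ : P j →ₗ[Λ] P b) (s : Λ),
      (ψ ⟨e j, hmem j⟩ : Λ) = (φ ⟨e j, hmem j⟩ : Λ) * s → ∃ s : P a →ₗ[Λ] P b, ψ = s ∘ₗ φ := by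
    intro j a b φ ψ s hs
    -- Right multiplication by `s` need not land in `P b`; a further right multiplication by `e b`
    -- corrects this without changing the composite.
    refine ⟨mulSpan (e b) ∘ₗ spanMap (e a) s, ?_⟩
    ext z
    change (ψ z : Λ) = ((φ z : Λ) * s) * e b
    rw [happ, happ j a, mul_assoc (z : Λ), ← hs, mul_assoc,
      mul_eq_of_mem_span (hp b).idem (ψ _).2]
  refine ⟨{
    I := Quotient st
    finite := inferInstance
    P := fun i => P i.out
    nontrivial := fun i => (hp i.out).isIndecomposable.1
    uniserial := fun i => (hp i.out).isUniserial hΛ.1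
    projective := fun i => projective_span_of_idem (hp i.out).idem
    not_simple := fun i h => hsimple _ h (projective_span_of_idem (hp i.out).idem)
    eq_of_equiv := fun i j h => by
      rw [← Quotient.out_eq i, ← Quotient.out_eq j]
      exact Quotient.sound h
    comparable := fun j a b φ ψ => by
      have hl : ∀ (j b : ι) (ψ : P j →ₗ[Λ] P b),
          e j * (ψ ⟨e j, hmem j⟩ : Λ) = ψ ⟨e j, hmem j⟩ := fun j b ψ =>
        (happ j b ψ ⟨e j, hmem j⟩).symm
      rcases (hp j.out).right_comparable hΛ.2 (hl _ _ φ) (hl _ _ ψ) with ⟨s, hs⟩ | ⟨s, hs⟩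
      · exact Or.inl (hcomp _ _ _ φ ψ s hs)
      · exact Or.inr (hcomp _ _ _ ψ φ s hs)
    ι := ι
    fintype := hι
    cl := fun a => Quotient.mk st a
    cl_surjective := Quotient.mk_surjective
    inc := fun a => (P a).subtype ∘ₗ (E a).toLinearMap
    proj := fun a => (E a).symm.toLinearMap ∘ₗ mulSpan (e a)
    proj_inc_self := fun a => by
      ext x : 1
      change (E a).symm (mulSpan (e a) (E a x : Λ)) = x
      rw [LinearEquiv.symm_apply_eq]
      ext
      exact mul_eq_of_mem_span (hp a).idem (E a x).2
    proj_inc_of_ne := fun a b hab => by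
      ext x : 1
      change (E a).symm (mulSpan (e a) (E b x : Λ)) = 0
      rw [LinearEquiv.symm_apply_eq, map_zero]
      ext
      change (E b x : Λ) * e a = 0
      rw [← mul_eq_of_mem_span (hp b).idem (E b x).2, mul_assoc, ho b a hab.symm, mul_zero]
    sum_inc_proj := by
      ext
      simp only [LinearMap.coe_sum, Finset.sum_apply, LinearMap.comp_apply,
        LinearEquiv.coe_coe, LinearEquiv.apply_symm_apply, Submodule.subtype_apply,
        LinearMap.id_apply]
      exact (Finset.sum_congr rfl fun c _ => one_mul (e c)).trans hs }⟩

/-! ### Length as a natural number. -/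

section Length

variable (Λ : Type u) [Ring Λ]

/-- The length of a module as a natural number. -/
noncomputable def len (M : Type*) [AddCommGroup M] [Module Λ M] : ℕ :=
  (Module.length Λ M).toNat

variable {Λ}
variable {M N : Type*} [AddCommGroup M] [Module Λ M] [AddCommGroup N] [Module Λ N]

theorem _root_.LinearEquiv.len_eq (e : M ≃ₗ[Λ] N) : len Λ M = len Λ N := by
  rw [len, len, e.length_eq]

theorem len_of_subsingleton [Subsingleton M] : len Λ M = 0 := by
  simp [len, Module.length_eq_zero]

theorem len_bot : len Λ (⊥ : Submodule Λ M) = 0 := len_of_subsingleton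

theorem len_top : len Λ (⊤ : Submodule Λ M) = len Λ M := Submodule.topEquiv.len_eq

theorem len_eq_one [IsSimpleModule Λ M] : len Λ M = 1 := by
  rw [len, Module.length_eq_one]; rfl

variable [IsArtinianRing Λ] [Module.Finite Λ M]

theorem coe_len : (len Λ M : ℕ∞) = Module.length Λ M :=
  ENat.natCast_toNat Module.length_ne_top

theorem len_pos [Nontrivial M] : 0 < len Λ M := by
  have := Module.length_pos (R := Λ) (M := M)
  rw [← coe_len] at this
  exact_mod_cast this

theorem nontrivial_of_len_pos (h : 0 < len Λ M) : Nontrivial M := by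
  by_contra hn
  rw [not_nontrivial_iff_subsingleton] at hn
  rw [len_of_subsingleton] at h
  exact h.false

theorem isSimpleModule_of_len (h : len Λ M = 1) : IsSimpleModule Λ M := by
  rw [← Module.length_eq_one_iff, ← coe_len, h]; rfl

theorem len_range_add_len_ker (f : M →ₗ[Λ] N) :
    len Λ (LinearMap.range f) + len Λ (LinearMap.ker f) = len Λ M := by
  have := Module.length_eq_add_of_exact (LinearMap.ker f).subtype f.rangeRestrict
    (Submodule.subtype_injective _) f.surjective_rangeRestrict
    (by
      intro x
      simp [LinearMap.rangeRestrict, ← Subtype.val_inj])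
  rw [← coe_len, ← coe_len, ← coe_len, add_comm] at this
  exact_mod_cast this.symm

theorem len_eq_add_len_ker (f : M →ₗ[Λ] N) (hf : Function.Surjective f) :
    len Λ N + len Λ (LinearMap.ker f) = len Λ M := by
  rw [← len_range_add_len_ker f, LinearMap.range_eq_top.2 hf, len_top]

theorem len_quotient_add (U : Submodule Λ M) : len Λ (M ⧸ U) + len Λ U = len Λ M := by
  have := len_eq_add_len_ker U.mkQ U.mkQ_surjective
  rwa [U.ker_mkQ] at this

theorem len_range_of_injective (f : M →ₗ[Λ] N) (hf : Function.Injective f) :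
    len Λ (LinearMap.range f) = len Λ M :=
  (LinearEquiv.ofInjective f hf).len_eq.symm

theorem len_map_add (f : M →ₗ[Λ] N) {U : Submodule Λ M} (hU : LinearMap.ker f ≤ U) :
    len Λ (U.map f) + len Λ (LinearMap.ker f) = len Λ U := by
  have h := len_range_add_len_ker (f.domRestrict U)
  rw [LinearMap.range_domRestrict] at h
  have e : LinearMap.ker (f.domRestrict U) ≃ₗ[Λ] LinearMap.ker f := by
    rw [LinearMap.ker_domRestrict]
    exact Submodule.submoduleOfEquivOfLe hU
  rw [← e.len_eq, h]

theorem len_comap (f : M →ₗ[Λ] N) (hf : Function.Surjective f) (U : Submodule Λ N) :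
    len Λ (U.comap f) = len Λ U + len Λ (LinearMap.ker f) := by
  rw [← len_map_add f (LinearMap.ker_le_comap f), Submodule.map_comap_eq_of_surjective hf]

theorem len_lt_of_lt {U V : Submodule Λ M} (h : U < V) : len Λ U < len Λ V := by
  have h1 := len_quotient_add (U.submoduleOf V)
  rw [(Submodule.submoduleOfEquivOfLe h.le).len_eq] at h1
  have : Nontrivial (V ⧸ U.submoduleOf V) := by
    rw [Submodule.Quotient.nontrivial_iff]
    intro h'
    exact h.not_ge (Submodule.submoduleOf_eq_top.1 h')
  have := len_pos (Λ := Λ) (M := V ⧸ U.submoduleOf V)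
  omega

theorem len_mono {U V : Submodule Λ M} (h : U ≤ V) : len Λ U ≤ len Λ V := by
  rcases h.eq_or_lt with rfl | h
  exacts [le_rfl, (len_lt_of_lt h).le]

theorem len_submodule_le (U : Submodule Λ M) : len Λ U ≤ len Λ M :=
  len_top (Λ := Λ) (M := M) ▸ len_mono le_top

theorem eq_top_of_len {U : Submodule Λ M} (h : len Λ M ≤ len Λ U) : U = ⊤ := by
  by_contra hU
  have := len_lt_of_lt (lt_top_iff_ne_top.2 hU)
  rw [len_top] at this
  omega

theorem eq_bot_of_len {U : Submodule Λ M} (h : len Λ U = 0) : U = ⊥ := by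
  by_contra hU
  have := len_lt_of_lt (bot_lt_iff_ne_bot.2 hU)
  omega

theorem len_pos_of_ne_bot {U : Submodule Λ M} (h : U ≠ ⊥) : 0 < len Λ U :=
  Nat.pos_of_ne_zero fun h' => h (eq_bot_of_len h')

theorem bijective_of_injective_of_len [Module.Finite Λ N] {f : M →ₗ[Λ] N}
    (hf : Function.Injective f) (h : len Λ N ≤ len Λ M) : Function.Bijective f :=
  ⟨hf, LinearMap.range_eq_top.1 (eq_top_of_len (by rwa [len_range_of_injective f hf]))⟩

theorem bijective_of_surjective_of_len {f : M →ₗ[Λ] N}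
    (hf : Function.Surjective f) (h : len Λ M ≤ len Λ N) : Function.Bijective f := by
  have := len_eq_add_len_ker f hf
  exact ⟨LinearMap.ker_eq_bot.1 (eq_bot_of_len (by omega)), hf⟩

theorem exists_submodule_len {k : ℕ} (hk : k ≤ len Λ M) :
    ∃ U : Submodule Λ M, len Λ U = k := by
  induction k with
  | zero => exact ⟨⊥, len_bot⟩
  | succ k ih =>
    obtain ⟨U, hU⟩ := ih (by omega)
    have hne : U ≠ ⊤ := by
      rintro rfl
      rw [len_top] at hU
      omega
    obtain ⟨V, hV, -⟩ := exists_covBy_le_of_lt (lt_top_iff_ne_top.2 hne)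
    refine ⟨V, ?_⟩
    have hs : IsSimpleModule Λ (V ⧸ U.submoduleOf V) := covBy_iff_quot_is_simple hV.le |>.1 hV
    have := len_quotient_add (U.submoduleOf V)
    rw [(Submodule.submoduleOfEquivOfLe hV.le).len_eq, len_eq_one] at this
    omega

end Length

/-! ### Uniserial modules. -/

section Uniserial

variable {Λ : Type u} [Ring Λ] {M N : Type u} [AddCommGroup M] [Module Λ M]
  [AddCommGroup N] [Module Λ N]

theorem IsUniserial.of_surjective (hM : IsUniserial Λ M) (f : M →ₗ[Λ] N)
    (hf : Function.Surjective f) : IsUniserial Λ N := fun U V => by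
  have := hM (U.comap f) (V.comap f)
  rwa [Submodule.comap_le_comap_iff_of_surjective hf,
    Submodule.comap_le_comap_iff_of_surjective hf] at this

theorem IsUniserial.of_injective (hN : IsUniserial Λ N) (f : M →ₗ[Λ] N)
    (hf : Function.Injective f) : IsUniserial Λ M := fun U V => by
  have := hN (U.map f) (V.map f)
  rwa [Submodule.map_le_map_iff_of_injective hf,
    Submodule.map_le_map_iff_of_injective hf] at this

theorem IsUniserial.eq_bot_or_eq_bot (hM : IsUniserial Λ M) {U V : Submodule Λ M}
    (h : Disjoint U V) : U = ⊥ ∨ V = ⊥ := by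
  rcases hM U V with h' | h'
  · exact Or.inl (h.eq_bot_of_le h')
  · exact Or.inr (h.symm.eq_bot_of_le h')

theorem IsUniserial.eq_top_or_eq_top (hM : IsUniserial Λ M) {U V : Submodule Λ M}
    (h : U ⊔ V = ⊤) : U = ⊤ ∨ V = ⊤ := by
  rcases hM U V with h' | h'
  · exact Or.inr (by rwa [sup_eq_right.2 h'] at h)
  · exact Or.inl (by rwa [sup_eq_left.2 h'] at h)

theorem IsUniserial.isIndecomposable [Nontrivial M] (hM : IsUniserial Λ M) :
    IsIndecomposable Λ M :=
  ⟨inferInstance, fun _ _ h => hM.eq_bot_or_eq_bot h.disjoint⟩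

/-- In a chain, length decides inclusion. This replaces all arguments with powers of the radical:
submodules are identified by computing their lengths. -/
theorem IsUniserial.le_of_len_le [IsArtinianRing Λ] [Module.Finite Λ M] (hM : IsUniserial Λ M)
    {U V : Submodule Λ M} (h : len Λ U ≤ len Λ V) : U ≤ V := by
  rcases hM U V with h' | h'
  · exact h'
  · rcases h'.eq_or_lt with h' | h'
    · exact h'.ge
    · have := len_lt_of_lt h'
      omega

theorem IsUniserial.eq_of_len_eq [IsArtinianRing Λ] [Module.Finite Λ M] (hM : IsUniserial Λ M)
    {U V : Submodule Λ M} (h : len Λ U = len Λ V) : U = V :=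
  le_antisymm (hM.le_of_len_le h.le) (hM.le_of_len_le h.ge)

theorem IsUniserial.injective_of_disjoint (hM : IsUniserial Λ M) (f : M →ₗ[Λ] N)
    {U : Submodule Λ M} (hU : U ≠ ⊥) (h : Disjoint U (LinearMap.ker f)) :
    Function.Injective f :=
  LinearMap.ker_eq_bot.1 ((hM.eq_bot_or_eq_bot h).resolve_left hU)

/-- The kernel of a map onto a non-zero module is proper, and proper submodules of a uniserial
module are superfluous. -/
theorem IsUniserial.surjective_of_comp {Q : Type*} [AddCommGroup Q] [Module Λ Q] [Nontrivial Q]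
    (hM : IsUniserial Λ M) (f : N →ₗ[Λ] M) (g : M →ₗ[Λ] Q)
    (h : Function.Surjective (g ∘ₗ f)) : Function.Surjective f := by
  have h1 : LinearMap.range f ⊔ LinearMap.ker g = ⊤ := by
    rw [eq_top_iff]
    intro x _
    obtain ⟨y, hy⟩ := h (g x)
    rw [← add_sub_cancel (f y) x]
    exact Submodule.add_mem_sup ⟨y, rfl⟩ (by simpa [sub_eq_zero] using hy.symm)
  rcases hM.eq_top_or_eq_top h1 with h2 | h2
  · exact LinearMap.range_eq_top.1 h2
  · exfalso
    obtain ⟨q, hq⟩ := exists_ne (0 : Q)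
    obtain ⟨y, hy⟩ := h q
    have : f y ∈ LinearMap.ker g := h2 ▸ Submodule.mem_top
    exact hq (hy ▸ this)

theorem IsUniserial.bijective_of_projective [Nontrivial N] [Module.Projective Λ N]
    (hM : IsUniserial Λ M) (f : M →ₗ[Λ] N) (hf : Function.Surjective f) :
    Function.Bijective f := by
  obtain ⟨s, hs⟩ := Module.projective_lifting_property f LinearMap.id hf
  have hsurj : Function.Surjective s :=
    hM.surjective_of_comp s f (by rw [hs]; exact Function.surjective_id)
  refine ⟨fun x y hxy => ?_, hf⟩
  obtain ⟨a, rfl⟩ := hsurj x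
  obtain ⟨b, rfl⟩ := hsurj y
  have ha : ∀ a, f (s a) = a := fun a => LinearMap.congr_fun hs a
  rw [ha, ha] at hxy
  rw [hxy]

end Uniserial

/-! ### Types of uniserial modules and the permutation `tau`. -/

namespace SerialFrame

variable {Λ : Type u} [Ring Λ] (F : SerialFrame Λ)

theorem sum_apply {M : Type*} [AddCommGroup M] [Module Λ M] (f : Λ →ₗ[Λ] M) :
    f = ∑ a, (f ∘ₗ F.inc a) ∘ₗ F.proj a := by
  conv_lhs => rw [← LinearMap.comp_id f, ← F.sum_inc_proj]
  ext
  simp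

/-- The length of the projective module `P i`. -/
noncomputable def c (i : F.I) : ℕ := len Λ (F.P i)

/-- `M` is a non-zero factor module of `P i` of length `l`. -/
structure IsU (M : Type u) [AddCommGroup M] [Module Λ M] (i : F.I) (l : ℕ) : Prop where
  exists_surjective : ∃ π : F.P i →ₗ[Λ] M, Function.Surjective π
  len_eq : len Λ M = l
  pos : 0 < l

variable [IsArtinianRing Λ]

theorem two_le_c (i : F.I) : 2 ≤ F.c i := by
  have h0 : 0 < F.c i := len_pos
  have h1 : F.c i ≠ 1 := fun h => F.not_simple i (isSimpleModule_of_len h)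
  omega

variable {F}
variable {M N : Type u} [AddCommGroup M] [Module Λ M] [AddCommGroup N] [Module Λ N] {i j : F.I}
  {l m : ℕ}

theorem isU_P (i : F.I) : F.IsU (F.P i) i (F.c i) :=
  ⟨⟨LinearMap.id, Function.surjective_id⟩, rfl, len_pos⟩

theorem IsU.finite (h : F.IsU M i l) : Module.Finite Λ M :=
  let ⟨π, hπ⟩ := h.exists_surjective
  Module.Finite.of_surjective π hπ

theorem IsU.isUniserial (h : F.IsU M i l) : IsUniserial Λ M :=
  let ⟨π, hπ⟩ := h.exists_surjective
  (F.uniserial i).of_surjective π hπ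

theorem IsU.nontrivial (h : F.IsU M i l) : Nontrivial M :=
  have := h.finite
  nontrivial_of_len_pos (Λ := Λ) (h.len_eq ▸ h.pos)

theorem IsU.of_surjective [Nontrivial N] (h : F.IsU M i l) (f : M →ₗ[Λ] N)
    (hf : Function.Surjective f) : F.IsU N i (len Λ N) := by
  obtain ⟨π, hπ⟩ := h.exists_surjective
  have : Module.Finite Λ N := Module.Finite.of_surjective (f ∘ₗ π) (hf.comp hπ)
  exact ⟨⟨f ∘ₗ π, hf.comp hπ⟩, rfl, len_pos⟩

theorem IsU.of_equiv (h : F.IsU M i l) (e : M ≃ₗ[Λ] N) : F.IsU N i l := by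
  obtain ⟨π, hπ⟩ := h.exists_surjective
  exact ⟨⟨e.toLinearMap ∘ₗ π, e.surjective.comp hπ⟩, e.len_eq ▸ h.len_eq, h.pos⟩

theorem IsU.le_c (h : F.IsU M i l) : l ≤ F.c i := by
  obtain ⟨π, hπ⟩ := h.exists_surjective
  have := len_eq_add_len_ker π hπ
  rw [h.len_eq] at this
  exact (Nat.le_add_right _ _).trans_eq this

/-- Both kernels in `P i` have length `c i - l`, so they coincide. -/
theorem IsU.nonempty_equiv (h : F.IsU M i l) (h' : F.IsU N i l) : Nonempty (M ≃ₗ[Λ] N) := by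
  obtain ⟨π, hπ⟩ := h.exists_surjective
  obtain ⟨ρ, hρ⟩ := h'.exists_surjective
  have h1 := len_eq_add_len_ker π hπ
  have h2 := len_eq_add_len_ker ρ hρ
  rw [h.len_eq] at h1
  rw [h'.len_eq] at h2
  have h3 : LinearMap.ker π = LinearMap.ker ρ := (F.uniserial i).eq_of_len_eq (by omega)
  exact ⟨(π.quotKerEquivOfSurjective hπ).symm.trans
    ((Submodule.quotEquivOfEq _ _ h3).trans (ρ.quotKerEquivOfSurjective hρ))⟩

theorem eq_of_surjective (f : F.P i →ₗ[Λ] F.P j) (hf : Function.Surjective f) : i = j :=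
  F.eq_of_equiv _ _
    ⟨LinearEquiv.ofBijective f ((F.uniserial i).bijective_of_projective f hf)⟩

theorem IsU.index_unique (h : F.IsU M i l) (h' : F.IsU M j m) : i = j := by
  obtain ⟨π, hπ⟩ := h.exists_surjective
  obtain ⟨ρ, hρ⟩ := h'.exists_surjective
  have := h.nontrivial
  obtain ⟨g, hg⟩ := Module.projective_lifting_property ρ π hρ
  exact eq_of_surjective g ((F.uniserial j).surjective_of_comp g ρ (by rwa [hg]))

theorem IsU.projective_iff (h : F.IsU M i l) : Module.Projective Λ M ↔ l = F.c i := by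
  obtain ⟨π, hπ⟩ := h.exists_surjective
  have := h.nontrivial
  constructor
  · intro hp
    rw [← h.len_eq]
    exact (LinearEquiv.ofBijective π ((F.uniserial i).bijective_of_projective π hπ)).len_eq.symm
  · intro hl
    have := bijective_of_surjective_of_len hπ (by rw [h.len_eq, hl]; rfl)
    exact Module.Projective.of_equiv (LinearEquiv.ofBijective π this)

/-- An element outside the maximal submodule has a component, along the decomposition of `Λ`, whose
image is not contained in that submodule; by uniseriality this image is everything. -/
theorem exists_surjective_of_isUniserial [Module.Finite Λ M] [Nontrivial M]
    (hM : IsUniserial Λ M) : ∃ (i : F.I) (π : F.P i →ₗ[Λ] M), Function.Surjective π := by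
  have hpos : 0 < len Λ M := len_pos
  obtain ⟨U, hU⟩ := exists_submodule_len (Λ := Λ) (M := M) (k := len Λ M - 1) (by omega)
  have hne : U ≠ ⊤ := by
    rintro rfl
    rw [len_top] at hU
    omega
  obtain ⟨x, -, hx⟩ := SetLike.exists_of_lt (lt_top_iff_ne_top.2 hne)
  have hsum := LinearMap.congr_fun (F.sum_apply (LinearMap.toSpanSingleton Λ M x)) 1
  have : ∃ a, ¬ LinearMap.range (LinearMap.toSpanSingleton Λ M x ∘ₗ F.inc a) ≤ U := by
    by_contra! hcon
    refine hx ?_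
    rw [LinearMap.toSpanSingleton_apply, one_smul, LinearMap.sum_apply] at hsum
    rw [hsum]
    exact U.sum_mem fun a _ => hcon a ⟨_, rfl⟩
  obtain ⟨a, ha⟩ := this
  refine ⟨F.cl a, LinearMap.toSpanSingleton Λ M x ∘ₗ F.inc a,
    LinearMap.range_eq_top.1 (eq_top_of_len ?_)⟩
  have hlt := (hM U _).resolve_right ha
  have := len_lt_of_lt (lt_of_le_of_ne hlt fun h => ha h.ge)
  omega

theorem exists_isU [Module.Finite Λ M] [Nontrivial M] (hM : IsUniserial Λ M) :
    ∃ i : F.I, F.IsU M i (len Λ M) :=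
  let ⟨i, h⟩ := exists_surjective_of_isUniserial (F := F) hM
  ⟨i, h, rfl, len_pos⟩

theorem exists_isU_of_simple [IsSimpleModule Λ M] : ∃ i : F.I, F.IsU M i 1 := by
  have := IsSimpleModule.nontrivial Λ M
  have hM : IsUniserial Λ M := fun U V => by
    rcases eq_bot_or_eq_top U with h | h
    · exact Or.inl (h ▸ bot_le)
    · exact Or.inr (h ▸ le_top)
  obtain ⟨i, h⟩ := exists_isU (F := F) hM
  exact ⟨i, by rwa [len_eq_one] at h⟩

variable (F) in
theorem exists_radical_cover (i : F.I) :
    ∃ (j : F.I) (t : F.P j →ₗ[Λ] F.P i), len Λ (LinearMap.range t) + 1 = F.c i := by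
  have h2 := F.two_le_c i
  obtain ⟨U, hU⟩ := exists_submodule_len (Λ := Λ) (M := F.P i) (k := F.c i - 1) (Nat.sub_le _ _)
  have : Nontrivial U := nontrivial_of_len_pos (Λ := Λ) (by omega)
  obtain ⟨j, π, hπ⟩ := exists_surjective_of_isUniserial (F := F)
    ((F.uniserial i).of_injective U.subtype U.subtype_injective)
  refine ⟨j, U.subtype ∘ₗ π, ?_⟩
  rw [LinearMap.range_comp, LinearMap.range_eq_top.2 hπ, Submodule.map_top, Submodule.range_subtype,
    hU]
  omega

variable (F) in
/-- `P (tau i)` is the projective cover of the radical of `P i`. -/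
noncomputable def tau (i : F.I) : F.I := (F.exists_radical_cover i).choose

variable (F) in
theorem exists_tau (i : F.I) :
    ∃ t : F.P (F.tau i) →ₗ[Λ] F.P i, len Λ (LinearMap.range t) + 1 = F.c i :=
  (F.exists_radical_cover i).choose_spec

variable (F) in
theorem c_le_c_tau (i : F.I) : F.c i ≤ F.c (F.tau i) + 1 := by
  obtain ⟨t, ht⟩ := F.exists_tau i
  have : len Λ (LinearMap.range t) + _ = F.c (F.tau i) := len_range_add_len_ker t
  omega

variable (F) in
theorem c_le_c_iterate (i : F.I) (r : ℕ) : F.c i ≤ F.c (F.tau^[r] i) + r := by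
  induction r with
  | zero => simp
  | succ r ih =>
    rw [Function.iterate_succ_apply']
    have := F.c_le_c_tau (F.tau^[r] i)
    omega

/-- Each application of `tau` lowers `c` by at most one, and by hypothesis the first one does not
lower it. -/
theorem c_lt_c_iterate (hi : F.c i ≤ F.c (F.tau i)) {r : ℕ} (hr : 0 < r) :
    F.c i < F.c (F.tau^[r] i) + r := by
  obtain ⟨r, rfl⟩ := Nat.exists_eq_succ_of_ne_zero hr.ne'
  have := F.c_le_c_iterate (F.tau i) r
  rw [Function.iterate_succ_apply]
  omega

/-- If `s` were not surjective, its image would lie in the radical `range t' = s (range t)`, so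
`range t` and `ker s` would span `P a`. But `range t` is proper, and `s = 0` would give `t' = 0`,
impossible because `P b` is not simple. -/
theorem eq_of_radical_covers {a b : F.I} (t : F.P j →ₗ[Λ] F.P a) (t' : F.P j →ₗ[Λ] F.P b)
    (ht : len Λ (LinearMap.range t) + 1 = F.c a) (ht' : len Λ (LinearMap.range t') + 1 = F.c b)
    (s : F.P a →ₗ[Λ] F.P b) (hs : t' = s ∘ₗ t) : a = b := by
  by_cases h : Function.Surjective s
  · exact eq_of_surjective s h
  exfalso
  have h1 : LinearMap.range s ≤ LinearMap.range t' := (F.uniserial b).le_of_len_le (by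
    by_contra hlt
    exact h (LinearMap.range_eq_top.1 (eq_top_of_len (by change F.c b ≤ _; omega))))
  have h2 : LinearMap.range t ⊔ LinearMap.ker s = ⊤ := by
    rw [eq_top_iff]
    intro x _
    obtain ⟨y, hy⟩ := h1 ⟨x, rfl⟩
    rw [hs] at hy
    rw [← add_sub_cancel (t y) x]
    exact Submodule.add_mem_sup ⟨y, rfl⟩ (by simpa [sub_eq_zero] using hy.symm)
  rcases (F.uniserial a).eq_top_or_eq_top h2 with h3 | h3
  · rw [h3, len_top] at ht
    exact absurd ht (Nat.succ_ne_self _)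
  · have h4 : t' = 0 := by
      rw [hs, LinearMap.ker_eq_top.1 h3, LinearMap.zero_comp]
    rw [h4, LinearMap.range_zero, len_bot] at ht'
    have := F.two_le_c b
    omega

variable (F) in
theorem tau_injective : Function.Injective F.tau := by
  intro a b hab
  obtain ⟨t, ht⟩ := F.exists_tau a
  obtain ⟨t', ht'⟩ : ∃ t' : F.P (F.tau a) →ₗ[Λ] F.P b,
      len Λ (LinearMap.range t') + 1 = F.c b := by
    rw [hab]
    exact F.exists_tau b
  rcases F.comparable _ _ _ t t' with ⟨s, hs⟩ | ⟨s, hs⟩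
  · exact eq_of_radical_covers t t' ht ht' s hs
  · exact (eq_of_radical_covers t' t ht' ht s hs).symm

variable (F) in
-- Composing radical covers lowers the length of the image by exactly one at each stage, as long as
-- the kernel of the previous composite is contained in the radical.
theorem exists_map_iterate (i : F.I) {r : ℕ} (hr : r < F.c i) :
    ∃ g : F.P (F.tau^[r] i) →ₗ[Λ] F.P i, len Λ (LinearMap.range g) + r = F.c i := by
  induction r with
  | zero =>
    rw [Function.iterate_zero_apply]
    exact ⟨LinearMap.id, by rw [LinearMap.range_id, len_top]; rfl⟩
  | succ r ih =>
    obtain ⟨g, hg⟩ := ih (by omega)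
    rw [Function.iterate_succ_apply']
    obtain ⟨t, ht⟩ := F.exists_tau (F.tau^[r] i)
    refine ⟨g ∘ₗ t, ?_⟩
    rw [LinearMap.range_comp]
    have h1 : len Λ (LinearMap.range g) + len Λ (LinearMap.ker g) = F.c (F.tau^[r] i) :=
      len_range_add_len_ker g
    have h2 : LinearMap.ker g ≤ LinearMap.range t := (F.uniserial _).le_of_len_le (by omega)
    have h3 := len_map_add g h2
    omega

/-- The preimage of `U` in `P i` is the image of a composite of radical covers, because the lengths
agree. -/
theorem IsU.submodule (h : F.IsU M i l) (U : Submodule Λ M) (hU : U ≠ ⊥) :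
    F.IsU U (F.tau^[l - len Λ U] i) (len Λ U) := by
  have := h.finite
  obtain ⟨π, hπ⟩ := h.exists_surjective
  have hpos := len_pos_of_ne_bot hU
  have hle := h.le_c
  have hle' := len_submodule_le U
  rw [h.len_eq] at hle'
  obtain ⟨g, hg⟩ := F.exists_map_iterate i (r := l - len Λ U) (by omega)
  have h1 : len Λ M + _ = F.c i := len_eq_add_len_ker π hπ
  rw [h.len_eq] at h1
  have h2 : LinearMap.range g = U.comap π := (F.uniserial i).eq_of_len_eq (by
    rw [len_comap π hπ]
    omega)
  have h3 : LinearMap.range (π ∘ₗ g) = U := by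
    rw [LinearMap.range_comp, h2, Submodule.map_comap_eq_of_surjective hπ]
  refine ⟨⟨(π ∘ₗ g).codRestrict U fun x => h3.le ⟨x, rfl⟩, ?_⟩, rfl, hpos⟩
  rintro ⟨y, hy⟩
  obtain ⟨x, hx⟩ := h3.ge hy
  exact ⟨x, Subtype.ext hx⟩

theorem IsU.quotient (h : F.IsU M i l) (U : Submodule Λ M) (hU : U ≠ ⊤) :
    F.IsU (M ⧸ U) i (len Λ (M ⧸ U)) :=
  have := Submodule.Quotient.nontrivial_iff.2 hU
  h.of_surjective U.mkQ U.mkQ_surjective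

theorem IsU.of_injective [Nontrivial N] (h : F.IsU M i l) (f : N →ₗ[Λ] M)
    (hf : Function.Injective f) : F.IsU N (F.tau^[l - len Λ N] i) (len Λ N) := by
  let e := LinearEquiv.ofInjective f hf
  have hne : LinearMap.range f ≠ ⊥ := by
    intro h0
    rw [LinearMap.range_eq_bot] at h0
    obtain ⟨x, hx⟩ := exists_ne (0 : N)
    exact hx (hf (by rw [h0]; rfl))
  rw [e.len_eq]
  exact (h.submodule _ hne).of_equiv e.symm

/-- The image of a non-zero map between two factor modules of indecomposable projectives. -/
theorem IsU.of_map (h : F.IsU M i l) (h' : F.IsU N j m) {f : M →ₗ[Λ] N} (hf : f ≠ 0) :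
    F.tau^[m - len Λ (LinearMap.range f)] j = i ∧ len Λ (LinearMap.range f) ≤ l ∧
      len Λ (LinearMap.range f) ≤ m ∧ 0 < len Λ (LinearMap.range f) := by
  have := h.finite
  have := h'.finite
  have h1 : LinearMap.range f ≠ ⊥ := fun h0 => hf (LinearMap.range_eq_bot.1 h0)
  have : Nontrivial (LinearMap.range f) := Submodule.nontrivial_iff_ne_bot.2 h1
  have h2 := len_range_add_len_ker f
  rw [h.len_eq] at h2
  have h3 := len_submodule_le (LinearMap.range f)
  rw [h'.len_eq] at h3
  exact ⟨(h'.submodule _ h1).index_unique (h.of_surjective _ f.surjective_rangeRestrict),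
    by omega, h3, len_pos_of_ne_bot h1⟩

end SerialFrame

/-! ### Decomposition into uniserial modules. -/

namespace SerialFrame

variable {Λ : Type u} [Ring Λ] {F : SerialFrame Λ}

/-- Comparability makes factorization a total preorder on maps out of `P b`, so a finite family has
a member through which all others factor. -/
theorem exists_dominant {κ : Type*} {b : F.I} {a : κ → F.I} (r : ∀ k, F.P b →ₗ[Λ] F.P (a k))
    (t : Finset κ) (ht : t.Nonempty) :
    ∃ k₀ ∈ t, ∀ k ∈ t, ∃ s : F.P (a k₀) →ₗ[Λ] F.P (a k), r k = s ∘ₗ r k₀ := by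
  classical
  induction ht using Finset.Nonempty.cons_induction with
  | singleton k =>
    refine ⟨k, Finset.mem_singleton_self k, fun k' hk' => ?_⟩
    obtain rfl := Finset.mem_singleton.1 hk'
    exact ⟨LinearMap.id, rfl⟩
  | cons k t hk ht ih =>
    obtain ⟨k₀, hk₀, h⟩ := ih
    rcases F.comparable _ _ _ (r k₀) (r k) with ⟨s, hs⟩ | ⟨s, hs⟩
    · refine ⟨k₀, Finset.mem_cons_of_mem hk₀, fun k' hk' => ?_⟩
      rcases Finset.mem_cons.1 hk' with rfl | hk'
      · exact ⟨s, hs⟩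
      · exact h k' hk'
    · refine ⟨k, Finset.mem_cons_self k t, fun k' hk' => ?_⟩
      rcases Finset.mem_cons.1 hk' with rfl | hk'
      · exact ⟨LinearMap.id, rfl⟩
      · obtain ⟨s', hs'⟩ := h k' hk'
        exact ⟨s' ∘ₗ s, by rw [hs', hs, LinearMap.comp_assoc]⟩

variable [IsArtinianRing Λ] {M : Type u} [AddCommGroup M] [Module Λ M]

/-- A relation `∑ g k ∘ r k = 0` has a dominant coefficient: `r k = σ k ∘ r k₀`. Replacing `g k₀` by
`∑ g k ∘ σ k` keeps the family generating, since `σ k₀ = id`, while the new map also kills the image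
of `r k₀`, so its image is shorter. -/
theorem exists_shorter_generators {κ : Type} [Fintype κ] {a : κ → F.I}
    (g : ∀ k, F.P (a k) →ₗ[Λ] M) (hg : ⨆ k, LinearMap.range (g k) = ⊤)
    (hind : ¬ iSupIndep fun k => LinearMap.range (g k)) :
    ∃ g' : ∀ k, F.P (a k) →ₗ[Λ] M, ⨆ k, LinearMap.range (g' k) = ⊤ ∧
      ∑ k, len Λ (LinearMap.range (g' k)) < ∑ k, len Λ (LinearMap.range (g k)) := by
  classical
  rw [iSupIndep_iff_finsetSum_eq_zero_imp_eq_zero] at hind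
  push Not at hind
  obtain ⟨s, y, hy, hsum, k₁, hk₁, hne⟩ := hind
  choose! z hz using hy
  -- the relation, as a family of maps from some `P b`
  obtain ⟨b, hb⟩ : ∃ b, LinearMap.toSpanSingleton Λ M (y k₁) ∘ₗ F.inc b ≠ 0 := by
    by_contra! hcon
    have := LinearMap.congr_fun (F.sum_apply (LinearMap.toSpanSingleton Λ M (y k₁))) 1
    simp only [hcon] at this
    simp at this
    exact hne this
  let r₀ : ∀ k, F.P (F.cl b) →ₗ[Λ] F.P (a k) := fun k =>
    LinearMap.toSpanSingleton Λ _ (z k) ∘ₗ F.inc b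
  have hr₀ : ∀ k ∈ s, g k ∘ₗ r₀ k = LinearMap.toSpanSingleton Λ M (y k) ∘ₗ F.inc b := by
    intro k hk
    ext x
    simp [r₀, hz k hk]
  -- Coefficients with `g k ∘ r₀ k = 0` are discarded, so that the dominant one cannot already be
  -- killed by `g k₀`.
  let r : ∀ k, F.P (F.cl b) →ₗ[Λ] F.P (a k) := fun k =>
    if k ∈ s ∧ g k ∘ₗ r₀ k ≠ 0 then r₀ k else 0
  have hrsum : ∑ k, g k ∘ₗ r k = 0 := by
    have h1 : ∀ k, g k ∘ₗ r k =
        if k ∈ s then LinearMap.toSpanSingleton Λ M (y k) ∘ₗ F.inc b else 0 := by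
      intro k
      by_cases hk : k ∈ s
      · by_cases h0 : g k ∘ₗ r₀ k = 0
        · simp [r, hk, h0, ← hr₀ k hk]
        · simp [r, hk, h0, ← hr₀ k hk]
      · simp [r, hk]
    simp only [h1]
    rw [Finset.sum_ite_mem, Finset.univ_inter]
    ext x
    simp [← Finset.smul_sum, hsum]
  have hrk₁ : r k₁ ≠ 0 := by
    have h0 : g k₁ ∘ₗ r₀ k₁ ≠ 0 := by rwa [hr₀ k₁ hk₁]
    intro h
    simp only [r, hk₁, h0, ne_eq, not_false_eq_true, and_self, if_true] at h
    exact h0 (by rw [h, LinearMap.comp_zero])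
  obtain ⟨k₀, -, hdom⟩ := exists_dominant r Finset.univ ⟨k₁, Finset.mem_univ _⟩
  have hdom' : ∀ k, ∃ s : F.P (a k₀) →ₗ[Λ] F.P (a k), r k = s ∘ₗ r k₀ ∧
      ∀ h : k₀ = k, s = h ▸ LinearMap.id := by
    intro k
    by_cases h : k₀ = k
    · subst h
      exact ⟨LinearMap.id, rfl, fun _ => rfl⟩
    · obtain ⟨s, hs⟩ := hdom k (Finset.mem_univ k)
      exact ⟨s, hs, fun h' => (h h').elim⟩
  choose σ hσ hσ₀ using hdom'
  have hσ₀ : σ k₀ = LinearMap.id := hσ₀ k₀ rfl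
  have hrk₀ : g k₀ ∘ₗ r k₀ ≠ 0 := by
    have h0 : r k₀ ≠ 0 := fun h => hrk₁ (by rw [hσ k₁, h, LinearMap.comp_zero])
    have h1 : k₀ ∈ s ∧ g k₀ ∘ₗ r₀ k₀ ≠ 0 := by
      by_contra hcon
      exact h0 (if_neg hcon)
    have h2 : r k₀ = r₀ k₀ := if_pos h1
    rw [h2]
    exact h1.2
  let h : F.P (a k₀) →ₗ[Λ] M := ∑ k, g k ∘ₗ σ k
  have hh : h ∘ₗ r k₀ = 0 := by
    rw [← hrsum]
    ext x
    simp only [h, LinearMap.comp_apply, LinearMap.sum_apply]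
    refine Finset.sum_congr rfl fun k _ => ?_
    rw [hσ k]
    rfl
  refine ⟨Function.update g k₀ h, ?_, ?_⟩
  · rw [eq_top_iff, ← hg]
    refine iSup_le fun k => ?_
    have hle : ∀ k, k ≠ k₀ → LinearMap.range (g k) ≤
        ⨆ k, LinearMap.range (Function.update g k₀ h k) := by
      intro k hk
      refine le_trans ?_ (le_iSup _ k)
      rw [Function.update_of_ne hk]
    by_cases hk : k = k₀
    · subst hk
      rintro _ ⟨x, rfl⟩
      have h1 : g k x = h x - ∑ k' ∈ Finset.univ.erase k, g k' (σ k' x) := by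
        simp only [h, LinearMap.sum_apply, LinearMap.comp_apply]
        rw [← Finset.add_sum_erase _ _ (Finset.mem_univ k), hσ₀]
        simp
      rw [h1]
      refine Submodule.sub_mem _ ?_ (Submodule.sum_mem _ fun k' hk' => ?_)
      · refine (le_iSup (fun k' => LinearMap.range (Function.update g k h k')) k) ?_
        simp only [Function.update_self]
        exact ⟨x, rfl⟩
      · exact hle k' (Finset.ne_of_mem_erase hk') ⟨_, rfl⟩
    · exact hle k hk
  · refine Finset.sum_lt_sum (fun k _ => ?_) ⟨k₀, Finset.mem_univ _, ?_⟩
    all_goals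
      have hlt : len Λ (LinearMap.range h) < len Λ (LinearMap.range (g k₀)) := by
        have h1 := len_range_add_len_ker h
        have h2 := len_range_add_len_ker (g k₀)
        have h3 : LinearMap.ker (g k₀) < LinearMap.ker h := by
          have h4 : ¬ LinearMap.ker h ≤ LinearMap.ker (g k₀) := by
            intro hle
            refine hrk₀ (LinearMap.ext fun x => hle ?_)
            exact LinearMap.congr_fun hh x
          exact lt_of_le_not_ge ((F.uniserial _ _ _).resolve_right h4) h4
        have := len_lt_of_lt h3
        omega
    · by_cases hk : k = k₀
      · subst hk
        rw [Function.update_self]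
        exact hlt.le
      · rw [Function.update_of_ne hk]
    · rwa [Function.update_self]

theorem exists_independent_generators {κ : Type} [Fintype κ] {a : κ → F.I}
    (g : ∀ k, F.P (a k) →ₗ[Λ] M) (hg : ⨆ k, LinearMap.range (g k) = ⊤) :
    ∃ g' : ∀ k, F.P (a k) →ₗ[Λ] M, ⨆ k, LinearMap.range (g' k) = ⊤ ∧
      iSupIndep fun k => LinearMap.range (g' k) := by
  induction hn : ∑ k, len Λ (LinearMap.range (g k)) using Nat.strong_induction_on
    generalizing g with
  | _ n ih =>
  by_cases hind : iSupIndep fun k => LinearMap.range (g k)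
  · exact ⟨g, hg, hind⟩
  · obtain ⟨g', hg', hlt⟩ := exists_shorter_generators g hg hind
    exact ih _ (hn ▸ hlt) g' hg' rfl

variable (F M) in
/-- A finitely generated module is a direct sum of finitely many uniserial modules. -/
theorem exists_decomposition [Module.Finite Λ M] :
    ∃ (n : ℕ) (N : Fin n → Submodule Λ M), (∀ k, ∃ i l, F.IsU (N k) i l) ∧
      DirectSum.IsInternal N := by
  classical
  obtain ⟨n, x, hx⟩ := Module.Finite.exists_fin (R := Λ) (M := M)
  obtain ⟨g, hg, hind⟩ := exists_independent_generators (F := F) (κ := Fin n × F.ι)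
    (a := fun k => F.cl k.2) (fun k => LinearMap.toSpanSingleton Λ M (x k.1) ∘ₗ F.inc k.2) (by
      rw [eq_top_iff, ← hx, Submodule.span_le]
      rintro _ ⟨k, rfl⟩
      have := LinearMap.congr_fun (F.sum_apply (LinearMap.toSpanSingleton Λ M (x k))) 1
      rw [LinearMap.toSpanSingleton_apply, one_smul, LinearMap.sum_apply] at this
      rw [SetLike.mem_coe, this]
      refine Submodule.sum_mem _ fun a _ => ?_
      exact Submodule.mem_iSup_of_mem (k, a) ⟨_, rfl⟩)
  -- Generators with zero image are dropped, since types describe only non-zero modules.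
  let κ := {k : Fin n × F.ι // LinearMap.range (g k) ≠ ⊥}
  let e := Fintype.equivFin κ
  refine ⟨Fintype.card κ, fun k => LinearMap.range (g (e.symm k).1), fun k => ?_, ?_⟩
  · have : Nontrivial (LinearMap.range (g (e.symm k).1)) :=
      Submodule.nontrivial_iff_ne_bot.2 (e.symm k).2
    exact ⟨_, _, (isU_P _).of_surjective _ (g (e.symm k).1).surjective_rangeRestrict⟩
  · refine DirectSum.isInternal_submodule_of_iSupIndep_of_iSup_eq_top ?_ ?_
    · exact hind.comp (Subtype.val_injective.comp e.symm.injective)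
    · rw [e.symm.iSup_comp (g := fun k : κ => LinearMap.range (g k.1)), ← hg]
      exact iSup_ne_bot_subtype _

variable (F M) in
theorem exists_isCompl [Module.Finite Λ M] [Nontrivial M] :
    ∃ (U V : Submodule Λ M) (i : F.I) (l : ℕ), IsCompl U V ∧ F.IsU U i l := by
  obtain ⟨n, N, hN, hdec⟩ := F.exists_decomposition M
  have hn : 0 < n := by
    rcases Nat.eq_zero_or_pos n with rfl | hn
    · have := hdec.submodule_iSup_eq_top
      rw [iSup_of_empty] at this
      exact (bot_ne_top this).elim
    · exact hn
  obtain ⟨i, l, h⟩ := hN ⟨0, hn⟩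
  refine ⟨_, _, i, l, ⟨hdec.submodule_iSupIndep ⟨0, hn⟩, ?_⟩, h⟩
  rw [codisjoint_iff, eq_top_iff, ← hdec.submodule_iSup_eq_top]
  refine iSup_le fun k => ?_
  by_cases hk : k = ⟨0, hn⟩
  · subst hk
    exact le_sup_left
  · exact le_sup_of_le_right (le_iSup₂_of_le k hk le_rfl)

end SerialFrame

/-! ### Factorization of maps into projectives. -/

section Factorization

variable {Λ : Type u} [Ring Λ] {X Y Z : Type*} [AddCommGroup X] [Module Λ X]
  [AddCommGroup Y] [Module Λ Y] [AddCommGroup Z] [Module Λ Z]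

/-- Every linear map `X → Z` factors through `g : X → Y`. -/
def FactorsThrough (g : X →ₗ[Λ] Y) (Z : Type*) [AddCommGroup Z] [Module Λ Z] : Prop :=
  ∀ ψ : X →ₗ[Λ] Z, ∃ s : Y →ₗ[Λ] Z, s ∘ₗ g = ψ

theorem FactorsThrough.of_projective {g : X →ₗ[Λ] Y} (h : FactorsThrough g Λ)
    [Module.Finite Λ Z] [Module.Projective Λ Z] : FactorsThrough g Z := by
  intro ψ
  obtain ⟨n, f, hf⟩ := Module.Finite.exists_fin' Λ Z
  obtain ⟨s, hs⟩ := Module.projective_lifting_property f LinearMap.id hf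
  choose t ht using fun k : Fin n => h (LinearMap.proj k ∘ₗ s ∘ₗ ψ)
  refine ⟨f ∘ₗ LinearMap.pi t, LinearMap.ext fun x => ?_⟩
  have h1 : LinearMap.pi t (g x) = s (ψ x) := funext fun k => LinearMap.congr_fun (ht k) x
  change f (LinearMap.pi t (g x)) = ψ x
  rw [h1]
  exact LinearMap.congr_fun hs (ψ x)

theorem SerialFrame.factorsThrough_ring (F : SerialFrame Λ) {g : X →ₗ[Λ] Y}
    (h : ∀ b, FactorsThrough g (F.P b)) : FactorsThrough g Λ := by
  intro ψ
  choose t ht using fun a => h (F.cl a) (F.proj a ∘ₗ ψ)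
  refine ⟨∑ a, F.inc a ∘ₗ t a, LinearMap.ext fun x => ?_⟩
  have h1 : ∀ a, t a (g x) = F.proj a (ψ x) := fun a => LinearMap.congr_fun (ht a) x
  simp only [LinearMap.comp_apply, LinearMap.sum_apply, h1]
  have := LinearMap.congr_fun F.sum_inc_proj (ψ x)
  simpa only [LinearMap.comp_apply, LinearMap.sum_apply, LinearMap.id_apply] using this

end Factorization

/-! ### Complete resolutions and their summands. -/

section CompleteResolution

variable {Λ : Type u} [Ring Λ]

/-- A complete projective resolution. -/
structure IsCompleteResolution (P : ℤ → ModuleCat.{u} Λ) (d : ∀ i, P (i + 1) →ₗ[Λ] P i) :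
    Prop where
  finite_projective : ∀ i, Module.Finite Λ (P i) ∧ Module.Projective Λ (P i)
  exact : ∀ i, Function.Exact (d (i + 1)) (d i)
  dual_exact : ∀ i, Function.Exact
      (fun φ : P i →ₗ[Λ] Λ => φ ∘ₗ d i)
      (fun φ : P (i + 1) →ₗ[Λ] Λ => φ ∘ₗ d (i + 1))

/-- Exactness of the dual complex is used only in this form: maps from an image to `Λ` extend to the
projective containing it. -/
theorem IsCompleteResolution.factorsThrough {P : ℤ → ModuleCat.{u} Λ}
    {d : ∀ i, P (i + 1) →ₗ[Λ] P i} (h : IsCompleteResolution P d) (k : ℤ) :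
    FactorsThrough (LinearMap.range (d k)).subtype Λ := by
  intro ψ
  obtain ⟨χ, hχ⟩ := (h.dual_exact k (ψ ∘ₗ (d k).rangeRestrict)).1 (by
    ext x
    have : (d k).rangeRestrict (d (k + 1) x) = 0 :=
      Subtype.ext ((h.exact k).apply_apply_eq_zero x)
    change ψ ((d k).rangeRestrict (d (k + 1) x)) = 0
    rw [this, map_zero])
  refine ⟨χ, LinearMap.ext ?_⟩
  rintro ⟨_, x, rfl⟩
  exact LinearMap.congr_fun hχ x

variable (Λ) in
/-- `M` is a direct summand of an image in a complete projective resolution. -/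
def IsGorensteinSummand (M : Type u) [AddCommGroup M] [Module Λ M] : Prop :=
  ∃ (P : ℤ → ModuleCat.{u} Λ) (d : ∀ i, P (i + 1) →ₗ[Λ] P i), IsCompleteResolution P d ∧
    ∃ (k : ℤ) (ι : M →ₗ[Λ] LinearMap.range (d k)) (r : LinearMap.range (d k) →ₗ[Λ] M),
      r ∘ₗ ι = LinearMap.id

variable {M N : Type u} [AddCommGroup M] [Module Λ M] [AddCommGroup N] [Module Λ N]

theorem IsGorensteinProjective.isGorensteinSummand (h : IsGorensteinProjective Λ M) :
    IsGorensteinSummand Λ M := by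
  obtain ⟨P, d, h1, h2, h3, ⟨e⟩⟩ := h
  exact ⟨P, d, ⟨h1, h2, h3⟩, 0, e, e.symm, by ext; simp⟩

theorem IsGorensteinProjective.finite (h : IsGorensteinProjective Λ M) : Module.Finite Λ M := by
  obtain ⟨P, d, h1, h2, h3, ⟨e⟩⟩ := h
  have := (h1 (0 + 1)).1
  exact Module.Finite.equiv e.symm

theorem IsGorensteinProjective.of_equiv (h : IsGorensteinProjective Λ M) (f : M ≃ₗ[Λ] N) :
    IsGorensteinProjective Λ N := by
  obtain ⟨P, d, h1, h2, h3, ⟨e⟩⟩ := h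
  exact ⟨P, d, h1, h2, h3, ⟨f.symm.trans e⟩⟩

theorem IsGorensteinSummand.of_retract (h : IsGorensteinSummand Λ M) (i : N →ₗ[Λ] M)
    (s : M →ₗ[Λ] N) (hs : s ∘ₗ i = LinearMap.id) : IsGorensteinSummand Λ N := by
  obtain ⟨P, d, hd, k, ι, r, hr⟩ := h
  refine ⟨P, d, hd, k, ι ∘ₗ i, s ∘ₗ r, ?_⟩
  rw [LinearMap.comp_assoc, ← LinearMap.comp_assoc i, hr, LinearMap.id_comp, hs]

end CompleteResolution

/-- A relation which is total in both directions admits bi-infinite sequences. -/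
theorem exists_int_sequence {α : Type*} (R : α → α → Prop) (hf : ∀ x, ∃ y, R x y)
    (hb : ∀ y, ∃ x, R x y) (x₀ : α) : ∃ z : ℤ → α, z 1 = x₀ ∧ ∀ k, R (z k) (z (k + 1)) := by
  choose f hf using hf
  choose b hb using hb
  let z : ℤ → α := fun k => match k with
    | Int.ofNat n => f^[n] x₀
    | Int.negSucc n => b^[n + 1] x₀
  have hz : ∀ k, R (z k) (z (k + 1)) := by
    rintro (n | n)
    · change R (f^[n] x₀) (f^[n + 1] x₀)
      rw [Function.iterate_succ_apply']
      exact hf _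
    · cases n with
      | zero => exact hb x₀
      | succ n =>
        change R (b^[n + 1 + 1] x₀) (b^[n + 1] x₀)
        rw [Function.iterate_succ_apply']
        exact hb _
  -- The shift puts `x₀` at index `1`, because the image of `d 0` is a factor module of the term of
  -- index `1`.
  refine ⟨fun k => z (k - 1), rfl, fun k => ?_⟩
  have := hz (k - 1)
  rwa [show k - 1 + 1 = k + 1 - 1 by ring] at this

/-! ### Which uniserial modules are Gorenstein projective. -/

namespace SerialFrame

variable {Λ : Type u} [Ring Λ] {F : SerialFrame Λ} [IsArtinianRing Λ]
variable {M : Type u} [AddCommGroup M] [Module Λ M] {i j : F.I} {l m : ℕ}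

/-- If a factor module of some indecomposable projective module embeds into an indecomposable
projective module, then a shortest such embedding is a left approximation. -/
theorem IsU.exists_approximation (hM : F.IsU M i l)
    (hex : ∃ (b : F.I) (f : M →ₗ[Λ] F.P b), Function.Injective f) :
    ∃ (h : F.I) (g : M →ₗ[Λ] F.P h), Function.Injective g ∧
      ∀ b, FactorsThrough g (F.P b) := by
  classical
  have := hM.nontrivial
  obtain ⟨π, hπ⟩ := hM.exists_surjective
  have hex' : ∃ n, ∃ (b : F.I) (f : M →ₗ[Λ] F.P b), Function.Injective f ∧ F.c b = n := by
    obtain ⟨b, f, hf⟩ := hex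
    exact ⟨_, b, f, hf, rfl⟩
  obtain ⟨h, g, hg, hc⟩ := Nat.find_spec hex'
  have hmin : ∀ (b : F.I) (f : M →ₗ[Λ] F.P b), Function.Injective f → F.c h ≤ F.c b := by
    intro b f hf
    rw [hc]
    exact Nat.find_min' hex' ⟨b, f, hf, rfl⟩
  refine ⟨h, g, hg, fun b ψ => ?_⟩
  -- If `g` factors through `ψ` instead, then `ψ` and the connecting map `s` are injective, and
  -- minimality of the target of `g` makes `s` invertible.
  rcases F.comparable _ _ _ (g ∘ₗ π) (ψ ∘ₗ π) with ⟨s, hs⟩ | ⟨s, hs⟩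
  · refine ⟨s, LinearMap.ext fun x => ?_⟩
    obtain ⟨y, rfl⟩ := hπ x
    exact (LinearMap.congr_fun hs y).symm
  · have hs' : g = s ∘ₗ ψ := by
      ext x : 1
      obtain ⟨y, rfl⟩ := hπ x
      exact LinearMap.congr_fun hs y
    have hψ : Function.Injective ψ := by
      rw [hs', LinearMap.coe_comp] at hg
      exact hg.of_comp
    have hne : LinearMap.range ψ ≠ ⊥ := by
      intro h0
      rw [LinearMap.range_eq_bot] at h0
      obtain ⟨x, hx⟩ := exists_ne (0 : M)
      exact hx (hψ (by rw [h0]; rfl))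
    have hsinj : Function.Injective s := (F.uniserial b).injective_of_disjoint s hne (by
      rw [Submodule.disjoint_def]
      rintro _ ⟨x, rfl⟩ hx
      have : g x = 0 := by rw [hs']; exact hx
      rw [hg (this.trans (map_zero g).symm), map_zero])
    have hbij := bijective_of_injective_of_len hsinj (hmin b ψ hψ)
    refine ⟨(LinearEquiv.ofBijective s hbij).symm, LinearMap.ext fun x => ?_⟩
    change (LinearEquiv.ofBijective s hbij).symm (g x) = ψ x
    rw [LinearEquiv.symm_apply_eq, hs']
    rfl

/-- The inclusion factors through a shortest approximation `N → P a` by an injection `P a → P i`.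
Then `a = tau^r i` with `r = c i - c a`, and `c_lt_c_iterate` forces `r = 0`; so the inclusion is
itself an approximation. -/
theorem factorsThrough_subtype (hi : F.c i ≤ F.c (F.tau i)) (N : Submodule Λ (F.P i))
    (hN : N ≠ ⊥) (b : F.I) : FactorsThrough N.subtype (F.P b) := by
  have hU := (isU_P i).submodule N hN
  obtain ⟨a, g, hg, happ⟩ := hU.exists_approximation ⟨i, N.subtype, N.subtype_injective⟩
  obtain ⟨s, hs⟩ := happ i N.subtype
  have : Nontrivial N := Submodule.nontrivial_iff_ne_bot.2 hN
  have hne : LinearMap.range g ≠ ⊥ := by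
    intro h0
    rw [LinearMap.range_eq_bot] at h0
    obtain ⟨x, hx⟩ := exists_ne (0 : N)
    exact hx (hg (by rw [h0]; rfl))
  have hsinj : Function.Injective s := (F.uniserial a).injective_of_disjoint s hne (by
    rw [Submodule.disjoint_def]
    rintro _ ⟨x, rfl⟩ hx
    have h1 : N.subtype x = 0 := by rw [← hs]; exact hx
    rw [N.subtype_injective (h1.trans (map_zero _).symm), map_zero])
  have hle : F.c a ≤ F.c i := by
    have : len Λ _ ≤ F.c i := len_submodule_le (LinearMap.range s)
    rwa [len_range_of_injective s hsinj] at this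
  have hca : F.c i ≤ F.c a := by
    by_contra hlt
    push Not at hlt
    have h1 := (isU_P i).of_injective s hsinj
    have h2 : F.tau^[F.c i - F.c a] i = a := h1.index_unique (isU_P a)
    have h3 := c_lt_c_iterate hi (r := F.c i - F.c a) (by omega)
    rw [h2] at h3
    omega
  have hbij := bijective_of_injective_of_len hsinj hca
  intro ψ
  obtain ⟨t, ht⟩ := happ b ψ
  refine ⟨t ∘ₗ (LinearEquiv.ofBijective s hbij).symm.toLinearMap, LinearMap.ext fun x => ?_⟩
  rw [← ht, ← hs]
  change t ((LinearEquiv.ofBijective s hbij).symm (s (g x))) = t (g x)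
  congr 1
  rw [LinearEquiv.symm_apply_eq]
  rfl

/-- A retraction of `G` onto a factor module of `P i` lifts to a retraction between the
projective modules. -/
theorem IsU.exists_lift (hM : F.IsU M i l) {π : F.P i →ₗ[Λ] M} (hπ : Function.Surjective π)
    {Q G : Type*} [AddCommGroup Q] [Module Λ Q] [Module.Projective Λ Q] [AddCommGroup G]
    [Module Λ G] {p : Q →ₗ[Λ] G} (hp : Function.Surjective p) {ι : M →ₗ[Λ] G} {r : G →ₗ[Λ] M}
    (hr : r ∘ₗ ι = LinearMap.id) :
    ∃ (a : F.P i →ₗ[Λ] Q) (b : Q →ₗ[Λ] F.P i), b ∘ₗ a = LinearMap.id ∧ p ∘ₗ a = ι ∘ₗ π ∧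
      π ∘ₗ b = r ∘ₗ p := by
  have := hM.nontrivial
  obtain ⟨a, ha⟩ := Module.projective_lifting_property p (ι ∘ₗ π) hp
  obtain ⟨b, hb⟩ := Module.projective_lifting_property π (r ∘ₗ p) hπ
  have h1 : π ∘ₗ (b ∘ₗ a) = π := by
    rw [← LinearMap.comp_assoc, hb, LinearMap.comp_assoc, ha, ← LinearMap.comp_assoc, hr,
      LinearMap.id_comp]
  have h2 : Function.Surjective (b ∘ₗ a) :=
    (F.uniserial i).surjective_of_comp _ π (by rwa [h1])
  -- The composite lifts the identity of `M`, so it is an automorphism; composing `b` with its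
  -- inverse gives an honest retraction, still compatible with `π`.
  let θ := LinearEquiv.ofBijective (b ∘ₗ a) (bijective_of_surjective_of_len h2 le_rfl)
  have hθ : ∀ x, π (θ.symm x) = π x := by
    intro x
    obtain ⟨y, rfl⟩ := θ.surjective x
    rw [LinearEquiv.symm_apply_apply]
    exact (LinearMap.congr_fun h1 y).symm
  refine ⟨a, θ.symm.toLinearMap ∘ₗ b, LinearMap.ext fun x => θ.symm_apply_apply x, ha,
    LinearMap.ext fun x => ?_⟩
  exact (hθ _).trans (LinearMap.congr_fun hb x)

/-- The lifted retraction restricts to the kernels, exhibiting `ker π` as a retract of the next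
image of the resolution, from which it inherits the extension property. -/
theorem IsU.ker_of_gorensteinSummand (hM : F.IsU M i l) (hG : IsGorensteinSummand Λ M)
    {π : F.P i →ₗ[Λ] M} (hπ : Function.Surjective π) :
    FactorsThrough (LinearMap.ker π).subtype Λ ∧ IsGorensteinSummand Λ (LinearMap.ker π) := by
  obtain ⟨P, d, hd, k, ι, r, hr⟩ := hG
  have := (hd.finite_projective (k + 1)).2
  obtain ⟨a, b, hba, ha, hb⟩ := hM.exists_lift hπ (d k).surjective_rangeRestrict hr
  have hka : ∀ x ∈ LinearMap.ker π, a x ∈ LinearMap.range (d (k + 1)) := by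
    intro x hx
    refine (hd.exact k (a x)).1 ?_
    have h1 : (d k).rangeRestrict (a x) = ι (π x) := LinearMap.congr_fun ha x
    rw [LinearMap.mem_ker.1 hx, map_zero] at h1
    exact congrArg Subtype.val h1
  have hkb : ∀ x ∈ LinearMap.range (d (k + 1)), b x ∈ LinearMap.ker π := by
    rintro _ ⟨y, rfl⟩
    have h1 : π (b (d (k + 1) y)) = r ((d k).rangeRestrict (d (k + 1) y)) :=
      LinearMap.congr_fun hb _
    have h2 : (d k).rangeRestrict (d (k + 1) y) = 0 :=
      Subtype.ext ((hd.exact k).apply_apply_eq_zero y)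
    rw [h2, map_zero] at h1
    exact h1
  let a' : LinearMap.ker π →ₗ[Λ] LinearMap.range (d (k + 1)) := a.restrict hka
  let b' : LinearMap.range (d (k + 1)) →ₗ[Λ] LinearMap.ker π := b.restrict hkb
  have hba' : b' ∘ₗ a' = LinearMap.id :=
    LinearMap.ext fun x => Subtype.ext (LinearMap.congr_fun hba x)
  refine ⟨fun ψ => ?_, P, d, hd, k + 1, a', b', hba'⟩
  obtain ⟨χ, hχ⟩ := hd.factorsThrough (k + 1) (ψ ∘ₗ b')
  refine ⟨χ ∘ₗ a, LinearMap.ext fun x => ?_⟩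
  exact (LinearMap.congr_fun hχ (a' x)).trans (congrArg ψ (LinearMap.congr_fun hba' x))

/-- Otherwise `P (tau i)` would be isomorphic to the radical of `P i`. The inclusion of the non-zero
`ker π` into this radical would extend to `P i`, injectively as it is injective on a non-zero
submodule, so the longer `P i` would embed into `P (tau i)`. -/
theorem IsU.c_le_of_gorensteinSummand (hM : F.IsU M i l) (hl : l < F.c i)
    (hG : IsGorensteinSummand Λ M) : F.c i ≤ F.c (F.tau i) := by
  by_contra hlt
  push Not at hlt
  obtain ⟨π, hπ⟩ := hM.exists_surjective
  have hext := (hM.ker_of_gorensteinSummand hG hπ).1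
  obtain ⟨t, ht⟩ := F.exists_tau i
  have h1 : len Λ (LinearMap.range t) + _ = F.c (F.tau i) := len_range_add_len_ker t
  have h2 : len Λ M + _ = F.c i := len_eq_add_len_ker π hπ
  have hpos := hM.pos
  rw [hM.len_eq] at h2
  have htinj : Function.Injective t := LinearMap.ker_eq_bot.1 (eq_bot_of_len (by omega))
  have hle : LinearMap.ker π ≤ LinearMap.range t := (F.uniserial i).le_of_len_le (by omega)
  obtain ⟨Ψ, hΨ⟩ := hext.of_projective (Z := F.P (F.tau i))
    ((LinearEquiv.ofInjective t htinj).symm.toLinearMap ∘ₗ Submodule.inclusion hle)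
  have hker : LinearMap.ker π ≠ ⊥ := by
    intro h0
    rw [h0, len_bot] at h2
    omega
  have hinj : Function.Injective Ψ := (F.uniserial i).injective_of_disjoint Ψ hker (by
    rw [Submodule.disjoint_def]
    intro x hx hx'
    have h3 : Ψ x = (LinearEquiv.ofInjective t htinj).symm ⟨x, hle hx⟩ :=
      LinearMap.congr_fun hΨ ⟨x, hx⟩
    rw [LinearMap.mem_ker.1 hx', eq_comm, LinearEquiv.symm_apply_eq, map_zero] at h3
    exact congrArg Subtype.val h3)
  have h4 := len_submodule_le (LinearMap.range Ψ)
  rw [len_range_of_injective Ψ hinj] at h4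
  exact hlt.not_ge h4

/-- Some coordinate of the embedding is non-zero on the simple socle, and in a uniserial module this
suffices for injectivity. -/
theorem IsU.exists_embedding (hM : F.IsU M i l) {Q : Type*} [AddCommGroup Q] [Module Λ Q]
    [Module.Projective Λ Q] (f : M →ₗ[Λ] Q) (hf : Function.Injective f) :
    ∃ (b : F.I) (f : M →ₗ[Λ] F.P b), Function.Injective f := by
  have := hM.finite
  have := hM.nontrivial
  obtain ⟨S, hS⟩ := exists_submodule_len (Λ := Λ) (M := M) (k := 1) len_pos
  have hSne : S ≠ ⊥ := by
    rintro rfl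
    rw [len_bot] at hS
    omega
  obtain ⟨x, hxS, hx⟩ := Submodule.exists_mem_ne_zero_of_ne_bot hSne
  obtain ⟨s, hs⟩ := Module.projective_def.1 ‹Module.Projective Λ Q›
  have h1 : s (f x) ≠ 0 := by
    intro h0
    have := hs (f x)
    rw [h0, map_zero] at this
    exact hx (hf (this.symm.trans (map_zero f).symm))
  obtain ⟨q, hq⟩ := Finsupp.ne_iff.1 h1
  let φ : M →ₗ[Λ] Λ := Finsupp.lapply q ∘ₗ s ∘ₗ f
  have hφ : φ x ≠ 0 := hq
  have h2 : ∃ a, F.proj a (φ x) ≠ 0 := by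
    by_contra! hcon
    have := LinearMap.congr_fun F.sum_inc_proj (φ x)
    simp only [LinearMap.comp_apply, LinearMap.sum_apply, hcon, map_zero,
      Finset.sum_const_zero] at this
    exact hφ this.symm
  obtain ⟨a, ha⟩ := h2
  refine ⟨F.cl a, F.proj a ∘ₗ φ, LinearMap.ker_eq_bot.1 (eq_bot_of_len ?_)⟩
  have h3 : ¬ S ≤ LinearMap.ker (F.proj a ∘ₗ φ) := fun h => ha (h hxS)
  have h4 := len_lt_of_lt (lt_of_le_not_ge ((hM.isUniserial _ _).resolve_left h3) h3)
  omega

/-- Both `M → P h` and the inclusion of the image in the resolution are approximations, so `ι` and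
`g ∘ r` extend to maps `α`, `ρ` between the projectives. Since `ρ ∘ α` fixes the image of `M`, it is
an automorphism, and `α` and the corrected `ρ` induce a retraction on cokernels. -/
theorem IsU.exists_cosyzygy (hM : F.IsU M i l) (hl : l < F.c i)
    (hG : IsGorensteinSummand Λ M) : ∃ h, l < F.c h ∧ F.tau^[F.c h - l] h = i ∧
      ∃ N : Submodule Λ (F.P h), F.IsU (F.P h ⧸ N) h (F.c h - l) ∧
        IsGorensteinSummand Λ (F.P h ⧸ N) := by
  have := hM.nontrivial
  have := hM.finite
  obtain ⟨P, d, hd, k, ι, r, hr⟩ := hG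
  obtain ⟨k, rfl⟩ : ∃ k', k = k' + 1 := ⟨k - 1, by ring⟩
  have hfin := (hd.finite_projective (k + 1)).1
  have hproj := (hd.finite_projective (k + 1)).2
  have hι : Function.Injective ι := fun x y hxy => by
    have := congrArg r hxy
    rwa [← LinearMap.comp_apply, ← LinearMap.comp_apply, hr] at this
  obtain ⟨h, g, hg, happ⟩ := hM.exists_approximation
    (hM.exists_embedding ((LinearMap.range (d (k + 1))).subtype ∘ₗ ι)
      ((Submodule.subtype_injective _).comp hι))
  have hgU := (isU_P h).of_injective g hg
  rw [hM.len_eq] at hgU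
  have hidx : F.tau^[F.c h - l] h = i := hgU.index_unique hM
  have hle : len Λ (LinearMap.range g) ≤ F.c h := len_submodule_le (LinearMap.range g)
  rw [len_range_of_injective g hg, hM.len_eq] at hle
  have hlt : l < F.c h := by
    refine lt_of_le_of_ne hle fun heq => hl.ne ?_
    rw [← hM.projective_iff]
    have hbij := bijective_of_injective_of_len hg (by rw [hM.len_eq, heq]; rfl)
    exact Module.Projective.of_equiv (LinearEquiv.ofBijective g hbij).symm
  obtain ⟨α, hα⟩ := (F.factorsThrough_ring happ).of_projective (Z := P (k + 1))
    ((LinearMap.range (d (k + 1))).subtype ∘ₗ ι)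
  obtain ⟨ρ, hρ⟩ := (hd.factorsThrough (k + 1)).of_projective (Z := F.P h) (g ∘ₗ r)
  have hα' : ∀ x, α (g x) = ι x := fun x => LinearMap.congr_fun hα x
  have hρ' : ∀ y : LinearMap.range (d (k + 1)), ρ y = g (r y) := fun y => LinearMap.congr_fun hρ y
  have hr' : ∀ x, r (ι x) = x := fun x => LinearMap.congr_fun hr x
  have hfix : ∀ x, (ρ ∘ₗ α) (g x) = g x := by
    intro x
    rw [LinearMap.comp_apply, hα', hρ', hr']
  have hne : LinearMap.range g ≠ ⊥ := by
    intro h0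
    rw [LinearMap.range_eq_bot] at h0
    obtain ⟨x, hx⟩ := exists_ne (0 : M)
    exact hx (hg (by rw [h0]; rfl))
  have hinj : Function.Injective (ρ ∘ₗ α) :=
    (F.uniserial h).injective_of_disjoint _ hne (by
      rw [Submodule.disjoint_def]
      rintro _ ⟨x, rfl⟩ hx
      rw [← hfix x]
      exact hx)
  let θ := LinearEquiv.ofBijective _ (bijective_of_injective_of_len hinj le_rfl)
  have hθ : ∀ x, θ.symm (g x) = g x := by
    intro x
    rw [LinearEquiv.symm_apply_eq]
    exact (hfix x).symm
  have hθ' : ∀ x, θ.symm (ρ (α x)) = x := fun x => θ.symm_apply_apply x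
  refine ⟨h, hlt, hidx, LinearMap.range g, ?_, ?_⟩
  · have h1 : len Λ _ + _ = F.c h := len_quotient_add (LinearMap.range g)
    rw [len_range_of_injective g hg, hM.len_eq] at h1
    rw [← h1, Nat.add_sub_cancel]
    refine (isU_P h).quotient _ fun h0 => ?_
    have h2 := len_range_of_injective g hg
    rw [h0, len_top, hM.len_eq] at h2
    exact hlt.ne' h2
  · let ι' : (F.P h ⧸ LinearMap.range g) →ₗ[Λ] LinearMap.range (d k) :=
      (LinearMap.range g).liftQ ((d k).rangeRestrict ∘ₗ α) (by
        rintro _ ⟨x, rfl⟩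
        rw [LinearMap.mem_ker, LinearMap.comp_apply, hα']
        exact Subtype.ext ((hd.exact k _).2 (ι x).2))
    let r' : (P (k + 1) ⧸ LinearMap.ker (d k)) →ₗ[Λ] (F.P h ⧸ LinearMap.range g) :=
      (LinearMap.ker (d k)).liftQ ((LinearMap.range g).mkQ ∘ₗ θ.symm.toLinearMap ∘ₗ ρ) (by
        intro x hx
        obtain ⟨y, rfl⟩ := (hd.exact k x).1 hx
        rw [LinearMap.mem_ker]
        refine (Submodule.Quotient.mk_eq_zero _).2 ⟨r ⟨d (k + 1) y, ⟨y, rfl⟩⟩, ?_⟩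
        have := hρ' ⟨d (k + 1) y, ⟨y, rfl⟩⟩
        change g _ = θ.symm (ρ (d (k + 1) y))
        rw [this, hθ])
    refine ⟨P, d, hd, k, ι', r' ∘ₗ (d k).quotKerEquivRange.symm.toLinearMap, ?_⟩
    apply Submodule.linearMap_qext
    ext x : 1
    have h2 : (d k).quotKerEquivRange.symm ((d k).rangeRestrict (α x)) =
        (LinearMap.ker (d k)).mkQ (α x) := by
      rw [LinearEquiv.symm_apply_eq]
      rfl
    change r' ((d k).quotKerEquivRange.symm ((d k).rangeRestrict (α x))) =
      (LinearMap.range g).mkQ x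
    rw [h2]
    change (LinearMap.range g).mkQ (θ.symm (ρ (α x))) = _
    rw [hθ']

variable (F) in
/-- `(i, l)` is the type of a non-projective direct summand of an image in a complete projective
resolution. -/
def IsGorensteinType (i : F.I) (l : ℕ) : Prop :=
  0 < l ∧ l < F.c i ∧ ∃ (M : Type u) (_ : AddCommGroup M) (_ : Module Λ M),
    F.IsU M i l ∧ IsGorensteinSummand Λ M

theorem IsGorensteinType.c_le (h : F.IsGorensteinType i l) : F.c i ≤ F.c (F.tau i) :=
  let ⟨_, h1, _, _, _, hM, hG⟩ := h
  hM.c_le_of_gorensteinSummand h1 hG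

theorem IsGorensteinType.syzygy (h : F.IsGorensteinType i l) :
    F.IsGorensteinType (F.tau^[l] i) (F.c i - l) := by
  have hc := h.c_le
  obtain ⟨h0, h1, M, _, _, hM, hG⟩ := h
  obtain ⟨π, hπ⟩ := hM.exists_surjective
  have h2 : len Λ M + _ = F.c i := len_eq_add_len_ker π hπ
  rw [hM.len_eq] at h2
  have h3 := c_lt_c_iterate hc h0
  have h4 : len Λ (LinearMap.ker π) = F.c i - l := by omega
  refine ⟨by omega, by omega, _, _, _, ?_, (hM.ker_of_gorensteinSummand hG hπ).2⟩
  have := (isU_P i).submodule (LinearMap.ker π) (fun h0 => by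
    rw [h0, len_bot] at h2
    omega)
  rwa [h4, Nat.sub_sub_self h1.le] at this

theorem IsGorensteinType.cosyzygy (h : F.IsGorensteinType i l) :
    ∃ h, l < F.c h ∧ F.tau^[F.c h - l] h = i ∧ F.IsGorensteinType h (F.c h - l) := by
  obtain ⟨h0, h1, M, _, _, hM, hG⟩ := h
  obtain ⟨h, h2, h3, N, hN, hGN⟩ := hM.exists_cosyzygy h1 hG
  exact ⟨h, h2, h3, by omega, by omega, _, _, _, hN, hGN⟩

variable (F) in
/-- `P i` is the projective cover of a non-projective module as in `IsGorensteinType`. -/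
def IsGorensteinVertex (i : F.I) : Prop := ∃ l, F.IsGorensteinType i l

theorem IsGorensteinVertex.c_le (h : F.IsGorensteinVertex i) : F.c i ≤ F.c (F.tau i) :=
  h.choose_spec.c_le

/-- Two syzygies advance the top by `l` and then by `c i - l`, in total independently of `l`. -/
theorem IsGorensteinVertex.iterate_c (h : F.IsGorensteinVertex i) :
    F.IsGorensteinVertex (F.tau^[F.c i] i) := by
  obtain ⟨l, h⟩ := h
  have h1 := h.syzygy.syzygy
  have h2 := h.2.1
  rw [← Function.iterate_add_apply, Nat.sub_add_cancel h2.le] at h1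
  exact ⟨_, h1⟩

theorem IsGorensteinVertex.exists_iterate_c (h : F.IsGorensteinVertex j) :
    ∃ i, F.IsGorensteinVertex i ∧ F.tau^[F.c i] i = j := by
  obtain ⟨l, h⟩ := h
  obtain ⟨h₁, hl, e₁, h'⟩ := h.cosyzygy
  obtain ⟨i, hl', e₂, h''⟩ := h'.cosyzygy
  refine ⟨i, ⟨_, h''⟩, ?_⟩
  rw [← Nat.add_sub_cancel' hl'.le, Function.iterate_add_apply, e₂, e₁]

variable (F) in
/-- The combinatorial description of the types of non-projective uniserial Gorenstein projective
modules. -/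
structure IsGoodType (i : F.I) (l : ℕ) : Prop where
  pos : 0 < l
  lt_c : l < F.c i
  vertex : F.IsGorensteinVertex i
  vertex_iterate : F.IsGorensteinVertex (F.tau^[l] i)

theorem IsGorensteinType.isGoodType (h : F.IsGorensteinType i l) : F.IsGoodType i l :=
  ⟨h.1, h.2.1, ⟨_, h⟩, ⟨_, h.syzygy⟩⟩

theorem IsGoodType.syzygy (h : F.IsGoodType i l) : F.IsGoodType (F.tau^[l] i) (F.c i - l) := by
  have h1 := c_lt_c_iterate h.vertex.c_le h.pos
  have h2 := h.lt_c
  refine ⟨by omega, by omega, h.vertex_iterate, ?_⟩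
  rw [← Function.iterate_add_apply, Nat.sub_add_cancel h2.le]
  exact h.vertex.iterate_c

/-- The projective `P k` is found by going two cosyzygies back from the vertex `tau^l i`. If `c k ≤
l`, injectivity would give `k = tau^(l - c k) i`, hence `c i ≤ l`. -/
theorem IsGoodType.cosyzygy (h : F.IsGoodType i l) :
    ∃ h, l < F.c h ∧ F.tau^[F.c h - l] h = i ∧ F.IsGoodType h (F.c h - l) := by
  obtain ⟨k, hk, e⟩ := h.vertex_iterate.exists_iterate_c
  have h0 := h.pos
  have hl : l < F.c k := by
    by_contra hle
    push Not at hle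
    have h1 : F.tau^[F.c k] k = F.tau^[F.c k] (F.tau^[l - F.c k] i) := by
      rw [← Function.iterate_add_apply, Nat.add_sub_cancel' hle, e]
    have h2 := (F.tau_injective.iterate _) h1
    have h3 := F.c_le_c_iterate i (l - F.c k)
    rw [← h2] at h3
    have := h.lt_c
    omega
  have h1 : F.tau^[F.c k - l] k = i := by
    apply F.tau_injective.iterate l
    rw [← Function.iterate_add_apply, Nat.add_sub_cancel' hl.le, e]
  exact ⟨k, hl, h1, by omega, by omega, hk, h1 ▸ h.vertex⟩

/-- Syzygies and cosyzygies of types give a bi-infinite sequence. Maps between consecutive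
projectives with prescribed image lengths form an exact complex by uniseriality, and the dual is
exact because all images are non-zero submodules of some `P j` with `j` a vertex. -/
theorem IsGoodType.isGorensteinProjective (h : F.IsGoodType i l) (hM : F.IsU M i l) :
    IsGorensteinProjective Λ M := by
  let α := {q : F.I × ℕ // F.IsGoodType q.1 q.2}
  let R : α → α → Prop := fun q q' => q'.1.1 = F.tau^[q.1.2] q.1.1 ∧ q'.1.2 = F.c q.1.1 - q.1.2
  obtain ⟨z, hz1, hz⟩ := exists_int_sequence R
    (fun q => ⟨⟨(_, _), q.2.syzygy⟩, rfl, rfl⟩)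
    (fun q => by
      obtain ⟨k, h1, h2, h3⟩ := q.2.cosyzygy
      refine ⟨⟨(_, _), h3⟩, h2.symm, ?_⟩
      change _ = F.c k - (F.c k - q.1.2)
      omega)
    ⟨(i, l), h⟩
  have hex : ∀ k, ∃ d : F.P (z (k + 1)).1.1 →ₗ[Λ] F.P (z k).1.1,
      len Λ (LinearMap.range d) = (z (k + 1)).1.2 := by
    intro k
    rw [(hz k).1, (hz k).2]
    obtain ⟨g, hg⟩ := F.exists_map_iterate (z k).1.1 (z k).2.lt_c
    exact ⟨g, by omega⟩
  choose d hd using hex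
  have hker : ∀ k, LinearMap.range (d (k + 1)) = LinearMap.ker (d k) := by
    intro k
    apply (F.uniserial _).eq_of_len_eq
    have h1 : len Λ _ + _ = F.c (z (k + 1)).1.1 := len_range_add_len_ker (d k)
    have h2 := hd k
    rw [hd (k + 1), (hz (k + 1)).2]
    omega
  refine ⟨fun k => ModuleCat.of Λ (F.P (z k).1.1), d, fun k => ⟨?_, F.projective _⟩, fun k => ?_,
    fun k φ => ⟨fun hφ => ?_, ?_⟩, ?_⟩
  · change Module.Finite Λ (F.P (z k).1.1)
    infer_instance
  · exact LinearMap.exact_iff.2 (hker k).symm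
  · have hle : LinearMap.ker (d k) ≤ LinearMap.ker φ := by
      rw [← hker k]
      rintro _ ⟨x, rfl⟩
      exact LinearMap.congr_fun hφ x
    let ψ : LinearMap.range (d k) →ₗ[Λ] Λ :=
      (LinearMap.ker (d k)).liftQ φ hle ∘ₗ (d k).quotKerEquivRange.symm.toLinearMap
    have hψ : ∀ x, ψ ((d k).rangeRestrict x) = φ x := by
      intro x
      have : (d k).quotKerEquivRange.symm ((d k).rangeRestrict x) =
          (LinearMap.ker (d k)).mkQ x := by
        rw [LinearEquiv.symm_apply_eq]
        rfl
      change (LinearMap.ker (d k)).liftQ φ hle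
        ((d k).quotKerEquivRange.symm ((d k).rangeRestrict x)) = _
      rw [this]
      rfl
    have hne : LinearMap.range (d k) ≠ ⊥ := by
      intro h0
      have h1 := hd k
      rw [h0, len_bot] at h1
      exact (z (k + 1)).2.pos.ne h1
    obtain ⟨s, hs⟩ := F.factorsThrough_ring
      (factorsThrough_subtype (z k).2.vertex.c_le (LinearMap.range (d k)) hne) ψ
    refine ⟨s, LinearMap.ext fun x => ?_⟩
    exact (LinearMap.congr_fun hs ((d k).rangeRestrict x)).trans (hψ x)
  · rintro ⟨χ, rfl⟩
    ext x
    have : d k (d (k + 1) x) = 0 := by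
      have h1 : d (k + 1) x ∈ LinearMap.ker (d k) := hker k ▸ ⟨x, rfl⟩
      exact h1
    change χ (d k (d (k + 1) x)) = 0
    rw [this, map_zero]
  · have h0 : z (0 + 1) = ⟨(i, l), h⟩ := hz1
    have hne : LinearMap.range (d 0) ≠ ⊥ := by
      intro h0
      have h1 := hd 0
      rw [h0, len_bot] at h1
      exact (z (0 + 1)).2.pos.ne h1
    have : Nontrivial (LinearMap.range (d 0)) := Submodule.nontrivial_iff_ne_bot.2 hne
    have h2 := (isU_P (z (0 + 1)).1.1).of_surjective _ (d 0).surjective_rangeRestrict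
    rw [hd 0] at h2
    have h3 : F.IsU M (z (0 + 1)).1.1 (z (0 + 1)).1.2 := by
      rw [h0]
      exact hM
    exact h3.nonempty_equiv h2

theorem IsU.isGorensteinProjective_of_summand (hM : F.IsU M i l) (hl : l < F.c i)
    (hG : IsGorensteinSummand Λ M) : IsGorensteinProjective Λ M :=
  IsGoodType.isGorensteinProjective
    (IsGorensteinType.isGoodType ⟨hM.pos, hl, _, _, _, hM, hG⟩) hM

theorem IsU.isGorensteinProjective_iff (hM : F.IsU M i l) (hl : l < F.c i) :
    IsGorensteinProjective Λ M ↔ F.IsGoodType i l :=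
  ⟨fun h => IsGorensteinType.isGoodType ⟨hM.pos, hl, _, _, _, hM, h.isGorensteinSummand⟩,
    fun h => h.isGorensteinProjective hM⟩

end SerialFrame

/-! ### Filtrations and extensions. -/

section Filtered

variable {Λ : Type u} [Ring Λ]

/-- Two subquotients which correspond to each other under a linear map are isomorphic. -/
theorem nonempty_subquotient_equiv {M N : Type*} [AddCommGroup M] [Module Λ M] [AddCommGroup N]
    [Module Λ N] (f : M →ₗ[Λ] N) {A B : Submodule Λ M} {A' B' : Submodule Λ N}
    (hB : B.map f ≤ B') (hB' : B' ≤ B.map f ⊔ A') (hA : A.map f ≤ A')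
    (hA' : B ⊓ A'.comap f ≤ A) :
    Nonempty ((B ⧸ A.submoduleOf B) ≃ₗ[Λ] (B' ⧸ A'.submoduleOf B')) := by
  let g : B →ₗ[Λ] (B' ⧸ A'.submoduleOf B') :=
    (A'.submoduleOf B').mkQ ∘ₗ f.restrict (p := B) (q := B') fun x hx => hB ⟨x, hx, rfl⟩
  have hg : Function.Surjective g := by
    intro y
    obtain ⟨⟨y, hy⟩, rfl⟩ := Submodule.mkQ_surjective _ y
    obtain ⟨_, ⟨x, hx, rfl⟩, a, ha, rfl⟩ := Submodule.mem_sup.1 (hB' hy)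
    refine ⟨⟨x, hx⟩, (Submodule.Quotient.eq _).2 ?_⟩
    simpa [Submodule.submoduleOf] using ha
  have hk : LinearMap.ker g = A.submoduleOf B := by
    ext ⟨x, hx⟩
    rw [LinearMap.mem_ker]
    change (A'.submoduleOf B').mkQ _ = 0 ↔ x ∈ A
    rw [Submodule.mkQ_apply, Submodule.Quotient.mk_eq_zero]
    exact ⟨fun h => hA' ⟨hx, h⟩, fun h => hA ⟨x, h, rfl⟩⟩
  exact ⟨(Submodule.quotEquivOfEq _ _ hk.symm).trans (g.quotKerEquivOfSurjective hg)⟩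

theorem nonempty_map_subquotient_equiv {M N : Type*} [AddCommGroup M] [Module Λ M]
    [AddCommGroup N] [Module Λ N] (f : M →ₗ[Λ] N) (hf : Function.Injective f)
    (A B : Submodule Λ M) :
    Nonempty ((B ⧸ A.submoduleOf B) ≃ₗ[Λ] (B.map f ⧸ (A.map f).submoduleOf (B.map f))) :=
  nonempty_subquotient_equiv f le_rfl le_sup_left le_rfl
    (by rw [Submodule.comap_map_eq_of_injective hf]; exact inf_le_right)

theorem nonempty_comap_subquotient_equiv {M N : Type*} [AddCommGroup M] [Module Λ M]
    [AddCommGroup N] [Module Λ N] (f : M →ₗ[Λ] N) (hf : Function.Surjective f)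
    (A B : Submodule Λ N) :
    Nonempty ((B.comap f ⧸ (A.comap f).submoduleOf (B.comap f)) ≃ₗ[Λ]
      (B ⧸ A.submoduleOf B)) :=
  nonempty_subquotient_equiv f (Submodule.map_comap_le _ _)
    (by rw [Submodule.map_comap_eq_of_surjective hf]; exact le_sup_left)
    (Submodule.map_comap_le _ _) inf_le_right

variable {𝓜 : ObjectProperty (ModuleCat.{u} Λ)}

theorem filtered_of_subsingleton (M : ModuleCat.{u} Λ) [Subsingleton M] : filtered 𝓜 M :=
  ⟨0, fun _ => ⊥, rfl, Subsingleton.elim _ _, fun i hi => (Nat.not_lt_zero i hi).elim⟩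

theorem filtered_of_mem
    (h𝓜 : ∀ M N : ModuleCat.{u} Λ, Nonempty (M ≃ₗ[Λ] N) → 𝓜 M → 𝓜 N)
    {M : ModuleCat.{u} Λ} (hM : 𝓜 M) : filtered 𝓜 M := by
  refine ⟨1, fun n => if n = 0 then ⊥ else ⊤, by simp, by simp, fun i hi => ?_⟩
  obtain rfl : i = 0 := by omega
  refine ⟨bot_le, h𝓜 M _ ⟨?_⟩ hM⟩
  have h1 : (⊥ : Submodule Λ M).submoduleOf ⊤ = ⊥ := by
    rw [Submodule.submoduleOf, ← LinearMap.ker, Submodule.ker_subtype]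
  exact (Submodule.topEquiv.symm.trans (Submodule.quotEquivOfEqBot _ h1).symm)

theorem filtered_of_exact
    (h𝓜 : ∀ M N : ModuleCat.{u} Λ, Nonempty (M ≃ₗ[Λ] N) → 𝓜 M → 𝓜 N)
    {A M C : ModuleCat.{u} Λ} (f : A →ₗ[Λ] M) (g : M →ₗ[Λ] C)
    (hf : Function.Injective f) (hg : Function.Surjective g)
    (hfg : LinearMap.range f = LinearMap.ker g) (hA : filtered 𝓜 A) (hC : filtered 𝓜 C) :
    filtered 𝓜 M := by
  obtain ⟨t, G, hG0, hGt, hG⟩ := hA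
  obtain ⟨t', H, hH0, hHt, hH⟩ := hC
  -- Images of the filtration of `A`, followed by preimages of that of `C`; both descriptions agree
  -- at index `t` because `range f = ker g`.
  let K : ℕ → Submodule Λ M := fun n => if n ≤ t then (G n).map f else (H (n - t)).comap g
  have hK1 : ∀ n, n ≤ t → K n = (G n).map f := fun n hn => if_pos hn
  have hK2 : ∀ n, K (t + n) = (H n).comap g := by
    intro n
    rcases Nat.eq_zero_or_pos n with rfl | hn
    · rw [add_zero, hK1 t le_rfl, hGt, hH0, Submodule.map_top, hfg]
      rfl
    · have h1 : ¬ t + n ≤ t := by omega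
      have h2 : t + n - t = n := by omega
      simp only [K, h1, if_false, h2]
  refine ⟨t + t', K, ?_, ?_, fun i hi => ?_⟩
  · rw [hK1 0 (Nat.zero_le t), hG0, Submodule.map_bot]
  · rw [hK2, hHt, Submodule.comap_top]
  · by_cases hit : i < t
    · rw [hK1 i hit.le, hK1 (i + 1) hit]
      exact ⟨Submodule.map_mono (hG i hit).1,
        h𝓜 _ _ (nonempty_map_subquotient_equiv f hf _ _) (hG i hit).2⟩
    · obtain ⟨n, rfl⟩ := Nat.exists_eq_add_of_le (not_lt.1 hit)
      have hn : n < t' := by omega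
      rw [add_assoc, hK2, hK2]
      refine ⟨Submodule.comap_mono (hH n hn).1, h𝓜 _ _ ?_ (hH n hn).2⟩
      obtain ⟨e⟩ := nonempty_comap_subquotient_equiv g hg (H n) (H (n + 1))
      exact ⟨e.symm⟩

theorem filtered_of_equiv
    (h𝓜 : ∀ M N : ModuleCat.{u} Λ, Nonempty (M ≃ₗ[Λ] N) → 𝓜 M → 𝓜 N)
    {M N : ModuleCat.{u} Λ} (e : M ≃ₗ[Λ] N) (hM : filtered 𝓜 M) :
    filtered 𝓜 N :=
  filtered_of_exact h𝓜 (A := M) (C := ModuleCat.of Λ PUnit) e.toLinearMap 0 e.injective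
    (fun _ => ⟨0, Subsingleton.elim _ _⟩) (by simp) hM (filtered_of_subsingleton _)

theorem filtered_pi
    (h𝓜 : ∀ M N : ModuleCat.{u} Λ, Nonempty (M ≃ₗ[Λ] N) → 𝓜 M → 𝓜 N)
    {n : ℕ} (X : Fin n → ModuleCat.{u} Λ) (hX : ∀ i, filtered 𝓜 (X i)) :
    filtered 𝓜 (ModuleCat.of Λ (∀ i, X i)) := by
  induction n with
  | zero =>
    have : Subsingleton (ModuleCat.of Λ (∀ i, X i)) :=
      inferInstanceAs (Subsingleton (∀ i, X i))
    exact filtered_of_subsingleton _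
  | succ n ih =>
    refine filtered_of_equiv h𝓜 (M := ModuleCat.of Λ (X 0 × ∀ i : Fin n, X i.succ))
      (Fin.consLinearEquiv Λ fun i => X i) ?_
    exact filtered_of_exact h𝓜 (A := X 0) (C := ModuleCat.of Λ (∀ i : Fin n, X i.succ))
      (LinearMap.inl Λ _ _) (LinearMap.snd Λ _ _) LinearMap.inl_injective
      LinearMap.snd_surjective (LinearMap.range_inl Λ _ _) (hX 0) (ih _ fun i => hX i.succ)

theorem filtered_directSum
    (h𝓜 : ∀ M N : ModuleCat.{u} Λ, Nonempty (M ≃ₗ[Λ] N) → 𝓜 M → 𝓜 N)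
    {n : ℕ} (X : Fin n → ModuleCat.{u} Λ) (hX : ∀ i, filtered 𝓜 (X i)) :
    filtered 𝓜 (ModuleCat.of Λ (⨁ i, X i)) :=
  filtered_of_equiv h𝓜 (M := ModuleCat.of Λ (∀ i, X i))
    (DirectSum.linearEquivFunOnFintype Λ (Fin n) fun i => X i).symm (filtered_pi h𝓜 X hX)

end Filtered

/-! ### Elementary modules and the Gorenstein core. -/

namespace SerialFrame

variable {Λ : Type u} [Ring Λ] {F : SerialFrame Λ} [IsArtinianRing Λ] {i j : F.I} {l m : ℕ}

variable (F) in
/-- The types of the elementary modules. -/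
structure IsElementaryType (i : F.I) (l : ℕ) : Prop extends F.IsGoodType i l where
  not_vertex : ∀ m, 0 < m → m < l → ¬ F.IsGorensteinVertex (F.tau^[m] i)

theorem IsElementaryType.unique (h : F.IsElementaryType i l) (h' : F.IsElementaryType i m) :
    l = m := by
  rcases lt_trichotomy l m with hlt | heq | hlt
  · exact (h'.not_vertex l h.pos hlt h.vertex_iterate).elim
  · exact heq
  · exact (h.not_vertex m h'.pos hlt h'.vertex_iterate).elim

theorem IsGorensteinVertex.exists_isElementaryType (h : F.IsGorensteinVertex i) :
    ∃ m, F.IsElementaryType i m := by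
  classical
  obtain ⟨l, hl⟩ := h
  have hg := hl.isGoodType
  have hex : ∃ m, 0 < m ∧ F.IsGorensteinVertex (F.tau^[m] i) := ⟨l, hg.pos, hg.vertex_iterate⟩
  have hs := Nat.find_spec hex
  refine ⟨Nat.find hex, ⟨hs.1, ?_, hg.vertex, hs.2⟩, fun m h0 h1 h2 => ?_⟩
  · exact (Nat.find_min' hex ⟨hg.pos, hg.vertex_iterate⟩).trans_lt hg.lt_c
  · exact Nat.find_min hex h1 ⟨h0, h2⟩

theorem IsElementaryType.le (h : F.IsElementaryType i m) (h0 : 0 < l)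
    (hl : F.IsGorensteinVertex (F.tau^[l] i)) : m ≤ l := by
  by_contra hlt
  exact h.not_vertex l h0 (not_le.1 hlt) hl

variable {M : Type u} [AddCommGroup M] [Module Λ M]

theorem IsU.exists_quotient (hM : F.IsU M i l) (h0 : 0 < m) (hm : m ≤ l) :
    ∃ U : Submodule Λ M, F.IsU (M ⧸ U) i m ∧ len Λ U = l - m := by
  have := hM.finite
  obtain ⟨U, hU⟩ := exists_submodule_len (Λ := Λ) (M := M) (k := l - m) (by rw [hM.len_eq]; omega)
  have h1 := len_quotient_add U
  rw [hU, hM.len_eq] at h1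
  have h2 := hM.quotient U (by
    rintro rfl
    rw [len_top, hM.len_eq] at hU
    omega)
  rw [show len Λ (M ⧸ U) = m by omega] at h2
  exact ⟨U, h2, hU⟩

variable (F) in
theorem exists_isU_of_le_c (i : F.I) (h0 : 0 < m) (hm : m ≤ F.c i) :
    ∃ N : ModuleCat.{u} Λ, F.IsU N i m := by
  obtain ⟨U, hU, -⟩ := (isU_P i).exists_quotient h0 hm
  exact ⟨ModuleCat.of Λ _, hU⟩

theorem gpIndec_iff (X : ModuleCat.{u} Λ) :
    gpIndec Λ X ↔ ∃ i l, F.IsU X i l ∧ F.IsGoodType i l := by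
  constructor
  · rintro ⟨⟨h1, h2⟩, h3, h4⟩
    have := h4.finite
    obtain ⟨U, V, i, l, hUV, hU⟩ := F.exists_isCompl X
    have hV : V = ⊥ := (h2 U V hUV).resolve_left
      (Submodule.nontrivial_iff_ne_bot.1 hU.nontrivial)
    have hU' : U = ⊤ := by
      rw [← hUV.sup_eq_top, hV, sup_bot_eq]
    have hX : F.IsU X i l := hU.of_equiv (LinearEquiv.ofTop U hU')
    have hl : l < F.c i := lt_of_le_of_ne hX.le_c fun h => h3 (hX.projective_iff.2 h)
    exact ⟨i, l, hX, (hX.isGorensteinProjective_iff hl).1 h4⟩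
  · rintro ⟨i, l, hX, h⟩
    have := hX.nontrivial
    exact ⟨hX.isUniserial.isIndecomposable, fun hp => h.lt_c.ne (hX.projective_iff.1 hp),
      h.isGorensteinProjective hX⟩

theorem IsU.gpZero {X : ModuleCat.{u} Λ} (hX : F.IsU X i l) (h : F.IsGoodType i l) :
    gpZero Λ X := by
  refine ⟨h.isGorensteinProjective hX, fun U V hUV hU hp => ?_⟩
  have hV : V = ⊥ := (hX.isUniserial.eq_bot_or_eq_bot hUV.disjoint).resolve_left
    (Submodule.nontrivial_iff_ne_bot.1 hU.1)
  have hU' : U = ⊤ := by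
    rw [← hUV.sup_eq_top, hV, sup_bot_eq]
  exact h.lt_c.ne (hX.projective_iff.1 (Module.Projective.of_equiv (LinearEquiv.ofTop U hU')))

theorem exists_summand_of_gpZero {X : ModuleCat.{u} Λ} (hX : NakayamaGP.gpZero Λ X)
    [Nontrivial X] : ∃ (U V : Submodule Λ X) (i : F.I) (l : ℕ), IsCompl U V ∧ F.IsU U i l ∧
      l < F.c i ∧ IsGorensteinProjective Λ U := by
  have := hX.1.finite
  obtain ⟨U, V, i, l, hUV, hU⟩ := F.exists_isCompl X
  have := hU.nontrivial
  have hl : l < F.c i := lt_of_le_of_ne hU.le_c fun h =>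
    hX.2 U V hUV hU.isUniserial.isIndecomposable (hU.projective_iff.2 h)
  refine ⟨U, V, i, l, hUV, hU, hl, hU.isGorensteinProjective_of_summand hl ?_⟩
  refine hX.1.isGorensteinSummand.of_retract U.subtype (Submodule.projectionOnto U V hUV) ?_
  ext x : 1
  exact Submodule.projectionOnto_apply_left hUV x

/-- A non-trivial decomposition would have a Gorenstein projective summand as a proper factor
module. For uniserial modules, the factor of length `m` has type `(i, m)`, whose only new condition
is that `tau^m i` be a vertex. -/
theorem elementary_iff (X : ModuleCat.{u} Λ) :
    elementary Λ X ↔ ∃ i l, F.IsU X i l ∧ F.IsElementaryType i l := by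
  constructor
  · rintro ⟨h1, h2, h3⟩
    obtain ⟨U, V, i, l, hUV, hU, hl, hG⟩ := exists_summand_of_gpZero (F := F) h1
    have hUne : U ≠ ⊥ := Submodule.nontrivial_iff_ne_bot.1 hU.nontrivial
    have hV : V = ⊥ := by
      by_contra hV
      refine h3 V hV ?_ (hG.of_equiv (Submodule.quotientEquivOfIsCompl V U hUV.symm).symm)
      rintro rfl
      exact hUne (disjoint_top.1 hUV.disjoint)
    have hU' : U = ⊤ := by
      rw [← hUV.sup_eq_top, hV, sup_bot_eq]
    have hX : F.IsU X i l := hU.of_equiv (LinearEquiv.ofTop U hU')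
    have hgood := (hU.isGorensteinProjective_iff hl).1 hG
    refine ⟨i, l, hX, hgood, fun m h0 hm hv => ?_⟩
    obtain ⟨W, hW, hlen⟩ := hX.exists_quotient h0 hm.le
    have := hW.nontrivial
    refine h3 W ?_ (Submodule.Quotient.nontrivial_iff.1 this) (IsGoodType.isGorensteinProjective
      ⟨h0, hm.trans hl, hgood.vertex, hv⟩ hW)
    rintro rfl
    rw [len_bot] at hlen
    omega
  · rintro ⟨i, l, hX, h⟩
    refine ⟨hX.gpZero h.toIsGoodType, hX.nontrivial, fun U hU hU' hG => ?_⟩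
    have := hX.finite
    have h1 := hX.quotient U hU'
    have h2 := len_quotient_add U
    rw [hX.len_eq] at h2
    have h3 := len_pos_of_ne_bot hU
    have h4 := h.lt_c
    have h5 := (h1.isGorensteinProjective_iff (by omega)).1 hG
    exact h.not_vertex _ h5.pos (by omega) h5.vertex_iterate

/-- The submodule of length `l - m` has type `(tau^m i, l - m)` and ends at the vertex `tau^l i`, so
the condition is again on `tau^m i` alone. -/
theorem elementaryDual_iff (X : ModuleCat.{u} Λ) :
    elementaryDual Λ X ↔ ∃ i l, F.IsU X i l ∧ F.IsElementaryType i l := by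
  constructor
  · rintro ⟨h1, h2, h3⟩
    obtain ⟨U, V, i, l, hUV, hU, hl, hG⟩ := exists_summand_of_gpZero (F := F) h1
    have hUne : U ≠ ⊥ := Submodule.nontrivial_iff_ne_bot.1 hU.nontrivial
    have hU' : U = ⊤ := by
      by_contra hU'
      exact h3 U hUne hU' hG
    have hX : F.IsU X i l := hU.of_equiv (LinearEquiv.ofTop U hU')
    have hgood := (hU.isGorensteinProjective_iff hl).1 hG
    refine ⟨i, l, hX, hgood, fun m h0 hm hv => ?_⟩
    obtain ⟨W, hW, hlen⟩ := hX.exists_quotient h0 hm.le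
    have hWne : W ≠ ⊥ := by
      rintro rfl
      rw [len_bot] at hlen
      omega
    have h4 := hX.submodule W hWne
    rw [hlen, Nat.sub_sub_self hm.le] at h4
    have h5 := F.c_le_c_iterate i m
    refine h3 W hWne (Submodule.Quotient.nontrivial_iff.1 hW.nontrivial)
      (IsGoodType.isGorensteinProjective ⟨by omega, by omega, hv, ?_⟩ h4)
    rw [← Function.iterate_add_apply, Nat.sub_add_cancel hm.le]
    exact hgood.vertex_iterate
  · rintro ⟨i, l, hX, h⟩
    refine ⟨hX.gpZero h.toIsGoodType, hX.nontrivial, fun U hU hU' hG => ?_⟩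
    have := hX.finite
    have h1 := hX.submodule U hU
    have h2 := len_lt_of_lt (lt_top_iff_ne_top.2 hU')
    rw [len_top, hX.len_eq] at h2
    have h3 := len_pos_of_ne_bot hU
    have h4 := h.lt_c
    have h5 := F.c_le_c_iterate i (l - len Λ U)
    have h6 := (h1.isGorensteinProjective_iff (by omega)).1 hG
    exact h.not_vertex _ (by omega) (by omega) h6.vertex

theorem elementary_of_equiv (F : SerialFrame Λ) (X Y : ModuleCat.{u} Λ) (e : Nonempty (X ≃ₗ[Λ] Y))
    (hX : elementary Λ X) : elementary Λ Y := by
  obtain ⟨e⟩ := e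
  rw [elementary_iff (F := F)] at hX ⊢
  obtain ⟨i, l, hX, h⟩ := hX
  exact ⟨i, l, hX.of_equiv e, h⟩

/-- Elementary factors are peeled off from the top. The case `l = c i` is included, which covers the
projective members of the core. -/
theorem IsU.filtered_elementary {X : ModuleCat.{u} Λ} (hX : F.IsU X i l)
    (hi : F.IsGorensteinVertex i) (hl : F.IsGorensteinVertex (F.tau^[l] i)) :
    filtered (elementary Λ) X := by
  induction l using Nat.strong_induction_on generalizing i X with
  | _ l ih =>
  obtain ⟨m, hm⟩ := hi.exists_isElementaryType
  have hml := hm.le hX.pos hl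
  obtain ⟨U, hU, hlen⟩ := hX.exists_quotient hm.pos hml
  have hq : filtered (elementary Λ) (ModuleCat.of Λ (X ⧸ U)) :=
    filtered_of_mem F.elementary_of_equiv ((elementary_iff _).2 ⟨i, m, hU, hm⟩)
  refine filtered_of_exact F.elementary_of_equiv (A := ModuleCat.of Λ U) U.subtype U.mkQ
    U.subtype_injective U.mkQ_surjective (by rw [U.range_subtype, U.ker_mkQ]) ?_ hq
  by_cases hUne : U = ⊥
  · have : Subsingleton (ModuleCat.of Λ U) := by
      change Subsingleton U
      rw [hUne]
      infer_instance
    exact filtered_of_subsingleton _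
  · have h1 := hX.submodule U hUne
    rw [hlen, Nat.sub_sub_self hml] at h1
    have hpos := hm.pos
    have hpos' := hX.pos
    refine ih (l - m) (by omega) (X := ModuleCat.of Λ U) h1 hm.vertex_iterate ?_
    rwa [← Function.iterate_add_apply, Nat.sub_add_cancel hml]

theorem isU_of_isProjectiveCover {X N : ModuleCat.{u} Λ} (hN : F.IsU N i l)
    (h : IsProjectiveCover Λ X N) : F.IsU X i (F.c i) := by
  obtain ⟨hp, π, hπ, hsup⟩ := h
  have := hN.nontrivial
  have := hπ.nontrivial
  obtain ⟨ρ, hρ⟩ := hN.exists_surjective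
  obtain ⟨a, ha⟩ := Module.projective_lifting_property π ρ hπ
  have hsurj : Function.Surjective a := by
    rw [← LinearMap.range_eq_top]
    apply hsup
    rw [eq_top_iff]
    intro x _
    obtain ⟨y, hy⟩ := hρ (π x)
    have hy' : π (a y) = π x := (LinearMap.congr_fun ha y).trans hy
    rw [← add_sub_cancel (a y) x]
    exact Submodule.add_mem_sup ⟨y, rfl⟩ (by simp [hy'])
  exact (isU_P i).of_equiv
    (LinearEquiv.ofBijective a ((F.uniserial i).bijective_of_projective a hsurj))

theorem IsU.isProjectiveCover {X N : ModuleCat.{u} Λ} (hX : F.IsU X i (F.c i))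
    (hN : F.IsU N i l) : IsProjectiveCover Λ X N := by
  obtain ⟨e⟩ := hX.nonempty_equiv (isU_P i)
  obtain ⟨π, hπ⟩ := hN.exists_surjective
  have := hN.nontrivial
  have hs : Function.Surjective (π ∘ₗ e.toLinearMap) := hπ.comp e.surjective
  refine ⟨hX.projective_iff.2 rfl, π ∘ₗ e.toLinearMap, hs, fun U hU => ?_⟩
  refine (hX.isUniserial.eq_top_or_eq_top hU).resolve_right fun h => ?_
  obtain ⟨x, hx⟩ := exists_ne (0 : N)
  obtain ⟨y, rfl⟩ := hs x
  exact hx (h ▸ Submodule.mem_top : y ∈ LinearMap.ker (π ∘ₗ e.toLinearMap))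

theorem filtered_of_core {X : ModuleCat.{u} Λ} (F : SerialFrame Λ) (hX : core Λ X) :
    filtered (elementary Λ) X := by
  obtain ⟨n, Y, hY, ⟨e⟩⟩ := hX
  refine filtered_of_equiv F.elementary_of_equiv (M := ModuleCat.of Λ (⨁ i, Y i)) e.symm
    (filtered_directSum F.elementary_of_equiv Y fun k => ?_)
  rcases hY k with h | ⟨N, h, hN⟩
  · obtain ⟨i, l, hU, hg⟩ := (gpIndec_iff (F := F) _).1 h
    exact hU.filtered_elementary hg.vertex hg.vertex_iterate
  · obtain ⟨i, l, hU, hg⟩ := (gpIndec_iff (F := F) _).1 h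
    exact (isU_of_isProjectiveCover hU hN).filtered_elementary hg.vertex hg.vertex.iterate_c

theorem finite_of_filtered {X : ModuleCat.{u} Λ} (F : SerialFrame Λ)
    (hX : filtered (elementary Λ) X) : Module.Finite Λ X := by
  obtain ⟨t, G, h0, ht, hG⟩ := hX
  have key : ∀ n, n ≤ t → Module.Finite Λ (G n) := by
    intro n
    induction n with
    | zero =>
      intro _
      rw [h0]
      infer_instance
    | succ n ih =>
      intro hn
      have h1 := ih (by omega)
      obtain ⟨i, l, hU, -⟩ := (elementary_iff (F := F) _).1 (hG n hn).2
      have h2 : Module.Finite Λ (G (n + 1) ⧸ (G n).submoduleOf (G (n + 1))) := hU.finite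
      have h3 : Module.Finite Λ ((G n).submoduleOf (G (n + 1))) :=
        Module.Finite.equiv (Submodule.submoduleOfEquivOfLe (hG n hn).1).symm
      exact Module.Finite.of_submodule_quotient ((G n).submoduleOf (G (n + 1)))
  have h1 := key t le_rfl
  rw [ht] at h1
  exact Module.Finite.equiv Submodule.topEquiv

/-- At the first filtration step where `f` does not vanish, it induces a non-zero map from an
elementary factor onto `S`, so `i` is the top of that factor. -/
theorem vertex_of_filtered_of_surjective {X : ModuleCat.{u} Λ} (hX : filtered (elementary Λ) X)
    {S : Type u} [AddCommGroup S] [Module Λ S] (hS : F.IsU S i 1) (f : X →ₗ[Λ] S) (hf : f ≠ 0) :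
    F.IsGorensteinVertex i := by
  obtain ⟨t, G, h0, ht, hG⟩ := hX
  obtain ⟨n, hn, h1, h2⟩ : ∃ n < t, G n ≤ LinearMap.ker f ∧ ¬ G (n + 1) ≤ LinearMap.ker f := by
    by_contra! hcon
    have key : ∀ n, n ≤ t → G n ≤ LinearMap.ker f := by
      intro n
      induction n with
      | zero =>
        intro _
        rw [h0]
        exact bot_le
      | succ n ih => exact fun hn => hcon n hn (ih (by omega))
    have h1 := key t le_rfl
    rw [ht, top_le_iff, LinearMap.ker_eq_top] at h1
    exact hf h1
  obtain ⟨e, m, hU, hE⟩ := (elementary_iff (F := F) _).1 (hG n hn).2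
  let g : (G (n + 1) ⧸ (G n).submoduleOf (G (n + 1))) →ₗ[Λ] S :=
    ((G n).submoduleOf (G (n + 1))).liftQ (f.domRestrict (G (n + 1))) fun x hx => h1 hx
  have hg : g ≠ 0 := by
    intro h3
    refine h2 fun x hx => ?_
    exact LinearMap.congr_fun h3 (((G n).submoduleOf (G (n + 1))).mkQ ⟨x, hx⟩)
  obtain ⟨h3, -, h4, h5⟩ := hU.of_map hS hg
  rw [show 1 - len Λ (LinearMap.range g) = 0 by omega, Function.iterate_zero_apply] at h3
  exact h3 ▸ hE.vertex

/-- The simple submodule embeds into an elementary factor of some type `(e, m)`, hence is its socle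
`tau^(m-1) e`; one more `tau` reaches the vertex `tau^m e`. -/
theorem vertex_tau_of_filtered_of_submodule {X : ModuleCat.{u} Λ}
    (hX : filtered (elementary Λ) X) (S : Submodule Λ X) (hS : F.IsU S i 1) :
    F.IsGorensteinVertex (F.tau i) := by
  have := hS.finite
  obtain ⟨t, G, h0, ht, hG⟩ := hX
  obtain ⟨n, hn, h1, h2⟩ : ∃ n < t, ¬ S ≤ G n ∧ S ≤ G (n + 1) := by
    by_contra! hcon
    have key : ∀ n, n ≤ t → ¬ S ≤ G n := by
      intro n
      induction n with
      | zero =>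
        intro _
        rw [h0, le_bot_iff]
        exact Submodule.nontrivial_iff_ne_bot.1 hS.nontrivial
      | succ n ih => exact fun hn => hcon n hn (ih (by omega))
    exact key t le_rfl (ht ▸ le_top)
  obtain ⟨e, m, hU, hE⟩ := (elementary_iff (F := F) _).1 (hG n hn).2
  let g : S →ₗ[Λ] (G (n + 1) ⧸ (G n).submoduleOf (G (n + 1))) :=
    ((G n).submoduleOf (G (n + 1))).mkQ ∘ₗ Submodule.inclusion h2
  have hg : g ≠ 0 := by
    intro h3
    refine h1 fun x hx => ?_
    have h4 : ((G n).submoduleOf (G (n + 1))).mkQ ⟨x, h2 hx⟩ = 0 :=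
      LinearMap.congr_fun h3 ⟨x, hx⟩
    rw [Submodule.mkQ_apply, Submodule.Quotient.mk_eq_zero] at h4
    exact h4
  obtain ⟨h3, h4, -, h5⟩ := hS.of_map hU hg
  have h6 : len Λ (LinearMap.range g) = 1 := le_antisymm h4 h5
  rw [h6] at h3
  have h7 := hE.vertex_iterate
  have h8 := hE.pos
  rwa [show m = m - 1 + 1 by omega, Function.iterate_succ_apply', h3] at h7

theorem core_of_filtered {X : ModuleCat.{u} Λ} (F : SerialFrame Λ)
    (hX : filtered (elementary Λ) X) : core Λ X := by
  have := finite_of_filtered F hX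
  obtain ⟨n, N, hN, hdec⟩ := F.exists_decomposition X
  let e : (⨁ k, N k) ≃ₗ[Λ] X := LinearEquiv.ofBijective (DirectSum.coeLinearMap N) hdec
  refine ⟨n, fun k => ModuleCat.of Λ (N k), fun k => ?_, ⟨e.symm⟩⟩
  obtain ⟨i, l, hU⟩ := hN k
  have := hU.finite
  have hpos := hU.pos
  have hi : F.IsGorensteinVertex i := by
    obtain ⟨W, hW, -⟩ := hU.exists_quotient (m := 1) one_pos hpos
    refine vertex_of_filtered_of_surjective hX hW
      (W.mkQ ∘ₗ DirectSum.component Λ _ _ k ∘ₗ e.symm.toLinearMap) ?_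
    have := hW.nontrivial
    intro h0
    obtain ⟨y, hy⟩ := exists_ne (0 : N k ⧸ W)
    obtain ⟨x, rfl⟩ := W.mkQ_surjective y
    refine hy ?_
    have h1 := LinearMap.congr_fun h0 (e (DirectSum.lof Λ _ (fun k => N k) k x))
    simpa [DirectSum.component.lof_self] using h1
  have hl : F.IsGorensteinVertex (F.tau^[l] i) := by
    obtain ⟨S, hS⟩ := exists_submodule_len (Λ := Λ) (M := N k) (k := 1)
      (by rw [hU.len_eq]; exact hpos)
    have h1 := hU.submodule S (by
      rintro rfl
      rw [len_bot] at hS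
      omega)
    rw [hS] at h1
    have h2 := vertex_tau_of_filtered_of_submodule hX (S.map (N k).subtype)
      (h1.of_equiv (Submodule.equivMapOfInjective _ (N k).subtype_injective S))
    rwa [← Function.iterate_succ_apply' F.tau, Nat.succ_eq_add_one, Nat.sub_add_cancel hpos] at h2
  rcases hU.le_c.lt_or_eq with hlt | heq
  · exact Or.inl ((gpIndec_iff _).2 ⟨i, l, hU, hpos, hlt, hi, hl⟩)
  · obtain ⟨m, hm⟩ := hi.exists_isElementaryType
    obtain ⟨Y, hY⟩ := F.exists_isU_of_le_c i hm.pos hm.lt_c.le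
    refine Or.inr ⟨Y, (gpIndec_iff _).2 ⟨i, m, hY, hm.toIsGoodType⟩, ?_⟩
    rw [heq] at hU
    exact IsU.isProjectiveCover (X := ModuleCat.of Λ (N k)) hU hY

end SerialFrame

/-! ### Counting composition factors along chains. -/

section Multiplicity

variable {Λ : Type u} [Ring Λ] (S : Type u) [AddCommGroup S] [Module Λ S]

/-- There is a chain of submodules from `A` to `B` with simple factors, exactly `n` of which are
isomorphic to `S`. -/
inductive HasChain {M : Type u} [AddCommGroup M] [Module Λ M] (A : Submodule Λ M) :
    Submodule Λ M → ℕ → Prop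
  | refl : HasChain A A 0
  | step_equiv {B C : Submodule Λ M} {n : ℕ} : HasChain A B n → B ⋖ C →
      Nonempty ((C ⧸ B.submoduleOf C) ≃ₗ[Λ] S) → HasChain A C (n + 1)
  | step_not_equiv {B C : Submodule Λ M} {n : ℕ} : HasChain A B n → B ⋖ C →
      ¬ Nonempty ((C ⧸ B.submoduleOf C) ≃ₗ[Λ] S) → HasChain A C n

variable {S}
variable {M N : Type u} [AddCommGroup M] [Module Λ M] [AddCommGroup N] [Module Λ N]

theorem HasChain.trans {A B C : Submodule Λ M} {m n : ℕ} (h : HasChain S A B m)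
    (h' : HasChain S B C n) : HasChain S A C (m + n) := by
  induction h' with
  | refl => exact h
  | step_equiv _ hc he ih => exact ih.step_equiv hc he
  | step_not_equiv _ hc he ih => exact ih.step_not_equiv hc he

theorem covBy_iff_isSimpleModule {A B : Submodule Λ M} (h : A ≤ B) :
    A ⋖ B ↔ IsSimpleModule Λ (B ⧸ A.submoduleOf B) :=
  covBy_iff_quot_is_simple h

theorem HasChain.map {A B : Submodule Λ M} {n : ℕ} (h : HasChain S A B n) (f : M →ₗ[Λ] N)
    (hf : Function.Injective f) : HasChain S (A.map f) (B.map f) n := by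
  have hcov : ∀ B C : Submodule Λ M, B ⋖ C → B.map f ⋖ C.map f := by
    intro B C hc
    obtain ⟨e⟩ := nonempty_map_subquotient_equiv f hf B C
    have := (covBy_iff_isSimpleModule hc.le).1 hc
    exact (covBy_iff_isSimpleModule (Submodule.map_mono hc.le)).2 (IsSimpleModule.congr e.symm)
  induction h with
  | refl => exact HasChain.refl
  | @step_equiv B C n _ hc he ih =>
    obtain ⟨e⟩ := nonempty_map_subquotient_equiv f hf B C
    exact ih.step_equiv (hcov _ _ hc) (he.map fun e' => e.symm.trans e')
  | @step_not_equiv B C n _ hc he ih =>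
    obtain ⟨e⟩ := nonempty_map_subquotient_equiv f hf B C
    exact ih.step_not_equiv (hcov _ _ hc) fun h => he (h.map fun e' => e.trans e')

theorem HasChain.comap {A B : Submodule Λ N} {n : ℕ} (h : HasChain S A B n) (f : M →ₗ[Λ] N)
    (hf : Function.Surjective f) : HasChain S (A.comap f) (B.comap f) n := by
  have hcov : ∀ B C : Submodule Λ N, B ⋖ C → B.comap f ⋖ C.comap f := by
    intro B C hc
    obtain ⟨e⟩ := nonempty_comap_subquotient_equiv f hf B C
    have := (covBy_iff_isSimpleModule hc.le).1 hc
    exact (covBy_iff_isSimpleModule (Submodule.comap_mono hc.le)).2 (IsSimpleModule.congr e)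
  induction h with
  | refl => exact HasChain.refl
  | @step_equiv B C n _ hc he ih =>
    obtain ⟨e⟩ := nonempty_comap_subquotient_equiv f hf B C
    exact ih.step_equiv (hcov _ _ hc) (he.map fun e' => e.trans e')
  | @step_not_equiv B C n _ hc he ih =>
    obtain ⟨e⟩ := nonempty_comap_subquotient_equiv f hf B C
    exact ih.step_not_equiv (hcov _ _ hc) fun h => he (h.map fun e' => e.symm.trans e')

theorem HasChain.of_exact {C : Type u} [AddCommGroup C] [Module Λ C] {m n : ℕ} (f : M →ₗ[Λ] N)
    (g : N →ₗ[Λ] C) (hf : Function.Injective f) (hg : Function.Surjective g)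
    (hfg : LinearMap.range f = LinearMap.ker g)
    (hM : HasChain S (⊥ : Submodule Λ M) ⊤ m) (hC : HasChain S (⊥ : Submodule Λ C) ⊤ n) :
    HasChain S (⊥ : Submodule Λ N) ⊤ (m + n) := by
  have h1 := hM.map f hf
  have h2 := hC.comap g hg
  rw [Submodule.map_bot, Submodule.map_top, hfg] at h1
  rw [Submodule.comap_top] at h2
  exact h1.trans h2

theorem HasChain.of_subsingleton [Subsingleton M] : HasChain S (⊥ : Submodule Λ M) ⊤ 0 := by
  rw [Subsingleton.elim (⊤ : Submodule Λ M) ⊥]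
  exact HasChain.refl

theorem HasChain.of_equiv {n : ℕ} (h : HasChain S (⊥ : Submodule Λ M) ⊤ n) (e : M ≃ₗ[Λ] N) :
    HasChain S (⊥ : Submodule Λ N) ⊤ n := by
  have := h.map e.toLinearMap e.injective
  rwa [Submodule.map_bot, Submodule.map_top, LinearEquiv.range] at this

theorem HasChain.pi {g : ℕ} (X : Fin g → ModuleCat.{u} Λ) (n : Fin g → ℕ)
    (hX : ∀ k, HasChain S (⊥ : Submodule Λ (X k)) ⊤ (n k)) :
    HasChain S (⊥ : Submodule Λ (∀ k, X k)) ⊤ (∑ k, n k) := by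
  induction g with
  | zero => exact HasChain.of_subsingleton
  | succ g ih =>
    rw [Fin.sum_univ_succ]
    refine HasChain.of_equiv (M := X 0 × ∀ k : Fin g, X k.succ) ?_
      (Fin.consLinearEquiv Λ fun i => X i)
    exact HasChain.of_exact (LinearMap.inl Λ _ _) (LinearMap.snd Λ _ _) LinearMap.inl_injective
      LinearMap.snd_surjective (LinearMap.range_inl Λ _ _) (hX 0) (ih _ _ fun i => hX i.succ)

theorem natCard_subtype_fin {n : ℕ} (p : Fin n → Prop) [DecidablePred p] :
    Nat.card {i // p i} = ∑ i, if p i then 1 else 0 := by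
  rw [Nat.card_eq_fintype_card, Fintype.card_subtype, Finset.card_filter]

theorem HasChain.exists_compositionSeries {A B : Submodule Λ M} {n : ℕ} (h : HasChain S A B n) :
    ∃ s : CompositionSeries (Submodule Λ M), s.head = A ∧ s.last = B ∧
      Nat.card {i : Fin s.length //
        Nonempty ((s i.succ ⧸ (s i.castSucc).submoduleOf (s i.succ)) ≃ₗ[Λ] S)} = n := by
  classical
  have key : ∀ (B C : Submodule Λ M) (s : CompositionSeries (Submodule Λ M)), s.head = A →
      s.last = B → B ⋖ C → ∃ s' : CompositionSeries (Submodule Λ M), s'.head = A ∧ s'.last = C ∧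
      Nat.card {i : Fin s'.length //
        Nonempty ((s' i.succ ⧸ (s' i.castSucc).submoduleOf (s' i.succ)) ≃ₗ[Λ] S)} =
      Nat.card {i : Fin s.length //
        Nonempty ((s i.succ ⧸ (s i.castSucc).submoduleOf (s i.succ)) ≃ₗ[Λ] S)} +
      if Nonempty ((C ⧸ B.submoduleOf C) ≃ₗ[Λ] S) then 1 else 0 := by
    intro B C s hA hB hc
    let t : Fin (s.length + 1 + 1) → Submodule Λ M := Fin.snoc (α := fun _ => Submodule Λ M) s C
    have ht1 : ∀ i : Fin (s.length + 1), t i.castSucc = s i := fun i => Fin.snoc_castSucc _ _ _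
    have ht2 : t (Fin.last _) = C := Fin.snoc_last _ _
    have hsB : s (Fin.last _) = B := hB
    let s' : CompositionSeries (Submodule Λ M) :=
      { length := s.length + 1
        toFun := t
        step := by
          intro i
          induction i using Fin.lastCases with
          | last =>
            change t (Fin.castSucc (Fin.last _)) ⋖ t (Fin.last _).succ
            rw [ht1, Fin.succ_last, ht2, hsB]
            exact hc
          | cast i =>
            change t (Fin.castSucc i.castSucc) ⋖ t i.castSucc.succ
            rw [Fin.succ_castSucc, ht1, ht1]
            exact s.step i }
    refine ⟨s', ?_, ht2, ?_⟩
    · rw [← hA]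
      exact ht1 0
    · rw [natCard_subtype_fin, natCard_subtype_fin]
      let q : Submodule Λ M → Submodule Λ M → Prop := fun U V =>
        Nonempty ((V ⧸ U.submoduleOf V) ≃ₗ[Λ] S)
      change (∑ i : Fin (s.length + 1), if q (t i.castSucc) (t i.succ) then 1 else 0) =
        (∑ i : Fin s.length, if q (s i.castSucc) (s i.succ) then 1 else 0) +
          if q B C then 1 else 0
      rw [Fin.sum_univ_castSucc]
      simp only [Fin.succ_castSucc, Fin.succ_last, ht1, ht2, hsB]
  induction h with
  | refl =>
    refine ⟨RelSeries.singleton _ A, rfl, rfl, ?_⟩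
    have : IsEmpty (Fin (RelSeries.singleton {(x, y) : Submodule Λ M × Submodule Λ M |
        JordanHolderLattice.IsMaximal x y} A).length) := Fin.isEmpty
    exact Nat.card_of_isEmpty
  | @step_equiv B C n _ hc he ih =>
    obtain ⟨s, h1, h2, h3⟩ := ih
    obtain ⟨s', h4, h5, h6⟩ := key B C s h1 h2 hc
    exact ⟨s', h4, h5, by rw [h6, h3, if_pos he]⟩
  | @step_not_equiv B C n _ hc he ih =>
    obtain ⟨s, h1, h2, h3⟩ := ih
    obtain ⟨s', h4, h5, h6⟩ := key B C s h1 h2 hc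
    exact ⟨s', h4, h5, by rw [h6, h3, if_neg he, add_zero]⟩

end Multiplicity

/-! ### Orbits of `tau`, multiplicities and orthogonality. -/

namespace SerialFrame

variable {Λ : Type u} [Ring Λ] {F : SerialFrame Λ} [IsArtinianRing Λ] {i j k : F.I} {l m : ℕ}
variable {S M : Type u} [AddCommGroup S] [Module Λ S] [AddCommGroup M] [Module Λ M]

open Classical in
theorem IsU.hasChain_simple (hS : F.IsU S k 1) (hM : F.IsU M i 1) :
    HasChain S (⊥ : Submodule Λ M) ⊤ (if i = k then 1 else 0) := by
  have := hM.finite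
  have := isSimpleModule_of_len hM.len_eq
  have hcov : (⊥ : Submodule Λ M) ⋖ ⊤ := bot_covBy_top
  have e : M ≃ₗ[Λ] ((⊤ : Submodule Λ M) ⧸ (⊥ : Submodule Λ M).submoduleOf ⊤) := by
    have h1 : (⊥ : Submodule Λ M).submoduleOf ⊤ = ⊥ := by
      rw [Submodule.submoduleOf, ← LinearMap.ker, Submodule.ker_subtype]
    exact Submodule.topEquiv.symm.trans (Submodule.quotEquivOfEqBot _ h1).symm
  by_cases hik : i = k
  · subst hik
    rw [if_pos rfl]
    obtain ⟨e'⟩ := hM.nonempty_equiv hS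
    exact HasChain.refl.step_equiv hcov ⟨e.symm.trans e'⟩
  · rw [if_neg hik]
    refine HasChain.refl.step_not_equiv hcov fun ⟨e'⟩ => hik ?_
    exact (hM.of_equiv (e.trans e')).index_unique hS

open Classical in
theorem IsU.hasChain (hS : F.IsU S k 1) (hM : F.IsU M i l) :
    HasChain S (⊥ : Submodule Λ M) ⊤ ((Finset.range l).filter fun r => F.tau^[r] i = k).card := by
  induction l generalizing i M with
  | zero => exact (lt_irrefl 0 hM.pos).elim
  | succ l ih =>
    obtain ⟨U, hU, hlen⟩ := hM.exists_quotient one_pos hM.pos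
    rw [Nat.add_sub_cancel] at hlen
    have h1 : HasChain S (⊥ : Submodule Λ U) ⊤
        ((Finset.range l).filter fun r => F.tau^[r] (F.tau i) = k).card := by
      by_cases h0 : U = ⊥
      · have : l = 0 := by rw [← hlen, h0, len_bot]
        subst this
        have : Subsingleton U := by
          rw [h0]
          infer_instance
        exact HasChain.of_subsingleton
      · have h2 := hM.submodule U h0
        rw [hlen, Nat.add_sub_cancel_left] at h2
        exact ih h2
    have h2 := HasChain.of_exact U.subtype U.mkQ U.subtype_injective U.mkQ_surjective
      (by rw [U.range_subtype, U.ker_mkQ]) h1 (hS.hasChain_simple hU)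
    convert h2 using 1
    rw [Finset.card_filter, Finset.card_filter, Finset.sum_range_succ']
    rfl

section Transitive

theorem mem_orbit_iff_of_map (hi : ∃ r, F.tau^[r] i = j) {f : F.P k →ₗ[Λ] F.P j} (hf : f ≠ 0) :
    ∃ r, F.tau^[r] i = k := by
  obtain ⟨h, -⟩ := (isU_P k).of_map (isU_P j) hf
  obtain ⟨r, rfl⟩ := hi
  exact ⟨_, by rw [Function.iterate_add_apply, h]⟩

theorem exists_iterate_symm (h : ∃ r, F.tau^[r] i = j) : ∃ r, F.tau^[r] j = i := by
  obtain ⟨r, rfl⟩ := h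
  obtain ⟨n, hn, hper⟩ := F.tau_injective.mem_periodicPts i
  have h1 : F.tau^[n * r] i = i := (hper.mul_const r)
  refine ⟨n * r - r, ?_⟩
  rw [← Function.iterate_add_apply, Nat.sub_add_cancel (Nat.le_mul_of_pos_left r hn), h1]

theorem ext_of_components {f g : Λ →ₗ[Λ] Λ}
    (h : ∀ a b, F.proj a ∘ₗ f ∘ₗ F.inc b = F.proj a ∘ₗ g ∘ₗ F.inc b) : f = g := by
  have h1 : ∀ a, F.proj a ∘ₗ f = F.proj a ∘ₗ g := by
    intro a
    rw [F.sum_apply (F.proj a ∘ₗ f), F.sum_apply (F.proj a ∘ₗ g)]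
    exact Finset.sum_congr rfl fun b _ => by
      rw [LinearMap.comp_assoc (F.inc b), LinearMap.comp_assoc (F.inc b), h]
  ext
  have h2 : ∀ x, x = ∑ a, F.inc a (F.proj a x) := fun x => by
    have := LinearMap.congr_fun F.sum_inc_proj x
    simpa only [LinearMap.comp_apply, LinearMap.sum_apply, LinearMap.id_apply] using this.symm
  rw [h2 (f 1), h2 (g 1)]
  exact Finset.sum_congr rfl fun a _ => congrArg (F.inc a) (LinearMap.congr_fun (h1 a) 1)

theorem comp_sum_linearMap {κ X Y Z : Type*} [AddCommGroup X] [Module Λ X] [AddCommGroup Y]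
    [Module Λ Y] [AddCommGroup Z] [Module Λ Z] (s : Finset κ) (f : Y →ₗ[Λ] Z)
    (g : κ → X →ₗ[Λ] Y) : f ∘ₗ (∑ b ∈ s, g b) = ∑ b ∈ s, f ∘ₗ g b := by
  ext x
  simp

theorem sum_comp_linearMap {κ X Y Z : Type*} [AddCommGroup X] [Module Λ X] [AddCommGroup Y]
    [Module Λ Y] [AddCommGroup Z] [Module Λ Z] (s : Finset κ) (f : κ → Y →ₗ[Λ] Z)
    (g : X →ₗ[Λ] Y) : (∑ b ∈ s, f b) ∘ₗ g = ∑ b ∈ s, f b ∘ₗ g := by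
  ext x
  simp

/-- The endomorphism of `Λ` which projects onto the summands with index in `O`. -/
noncomputable def blockEnd (F : SerialFrame Λ) (O : Set F.I) : Λ →ₗ[Λ] Λ :=
  open Classical in ∑ a, if F.cl a ∈ O then F.inc a ∘ₗ F.proj a else 0

open Classical in
theorem proj_comp_blockEnd (O : Set F.I) (a : F.ι) :
    F.proj a ∘ₗ F.blockEnd O = if F.cl a ∈ O then F.proj a else 0 := by
  rw [blockEnd, comp_sum_linearMap, Finset.sum_eq_single a]
  · split_ifs
    · rw [← LinearMap.comp_assoc, F.proj_inc_self, LinearMap.id_comp]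
    · rw [LinearMap.comp_zero]
  · intro b _ hb
    split_ifs
    · rw [← LinearMap.comp_assoc, F.proj_inc_of_ne a b hb.symm, LinearMap.zero_comp]
    · rw [LinearMap.comp_zero]
  · simp

open Classical in
theorem blockEnd_comp_inc (O : Set F.I) (a : F.ι) :
    F.blockEnd O ∘ₗ F.inc a = if F.cl a ∈ O then F.inc a else 0 := by
  rw [blockEnd, sum_comp_linearMap, Finset.sum_eq_single a]
  · split_ifs
    · rw [LinearMap.comp_assoc, F.proj_inc_self, LinearMap.comp_id]
    · rw [LinearMap.zero_comp]
  · intro b _ hb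
    split_ifs
    · rw [LinearMap.comp_assoc, F.proj_inc_of_ne b a hb, LinearMap.comp_zero]
    · rw [LinearMap.zero_comp]
  · simp

variable (F) in
/-- Over a connected ring, `tau` is a cyclic permutation. -/
theorem exists_iterate_eq (hΛ : IsConnectedRing Λ) (i k : F.I) : ∃ r, F.tau^[r] i = k := by
  classical
  let O : Set F.I := {k | ∃ r, F.tau^[r] i = k}
  have hO : ∀ {a b : F.I} (f : F.P a →ₗ[Λ] F.P b), f ≠ 0 → (a ∈ O ↔ b ∈ O) := by
    intro a b f hf
    refine ⟨fun ha => ?_, fun hb => mem_orbit_iff_of_map hb hf⟩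
    obtain ⟨r, hr⟩ := ha
    obtain ⟨r', hr'⟩ := exists_iterate_symm (mem_orbit_iff_of_map ⟨0, rfl⟩ hf)
    exact ⟨r' + r, by rw [Function.iterate_add_apply, hr, hr']⟩
  -- There are no non-zero maps between projectives inside and outside the orbit, so the block
  -- projection commutes with all right multiplications and its value at `1` is central.
  have hcomm : ∀ x : Λ →ₗ[Λ] Λ, F.blockEnd O ∘ₗ x = x ∘ₗ F.blockEnd O := by
    intro x
    refine ext_of_components (F := F) fun a b => ?_
    change (F.proj a ∘ₗ F.blockEnd O) ∘ₗ x ∘ₗ F.inc b =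
      (F.proj a ∘ₗ x) ∘ₗ F.blockEnd O ∘ₗ F.inc b
    rw [proj_comp_blockEnd, blockEnd_comp_inc]
    by_cases h0 : F.proj a ∘ₗ x ∘ₗ F.inc b = 0
    · split_ifs <;> simp [h0, LinearMap.comp_assoc]
    · have h1 := hO _ h0
      by_cases h2 : F.cl b ∈ O
      · rw [if_pos h2, if_pos (h1.1 h2), LinearMap.comp_assoc]
      · rw [if_neg h2, if_neg fun h => h2 (h1.2 h)]
        simp
  have hidem : F.blockEnd O ∘ₗ F.blockEnd O = F.blockEnd O := by
    refine ext_of_components (F := F) fun a b => ?_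
    rw [LinearMap.comp_assoc, blockEnd_comp_inc]
    split_ifs with h
    · rw [blockEnd_comp_inc, if_pos h]
    · simp
  have happ : ∀ y, F.blockEnd O y = y * F.blockEnd O 1 := by
    intro y
    rw [← smul_eq_mul, ← map_smul, smul_eq_mul, mul_one]
  obtain ⟨-, hcon⟩ := hΛ
  have hcenter : F.blockEnd O 1 ∈ Set.center Λ := by
    rw [Semigroup.mem_center_iff]
    intro x
    have := LinearMap.congr_fun (hcomm (LinearMap.toSpanSingleton Λ Λ x)) 1
    simp only [LinearMap.comp_apply, LinearMap.toSpanSingleton_apply, smul_eq_mul,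
      one_mul] at this
    rw [← this, ← happ]
  have hi : IsIdempotentElem (F.blockEnd O 1) := by
    have := LinearMap.congr_fun hidem 1
    rw [LinearMap.comp_apply, happ] at this
    exact this
  obtain ⟨a, ha⟩ := F.cl_surjective i
  obtain ⟨b, hb⟩ := F.cl_surjective k
  have haO : F.cl a ∈ O := ⟨0, ha.symm⟩
  have hne : ∀ a, (LinearMap.id : F.P (F.cl a) →ₗ[Λ] F.P (F.cl a)) ≠ 0 := by
    intro a h
    obtain ⟨x, hx⟩ := exists_ne (0 : F.P (F.cl a))
    exact hx (LinearMap.congr_fun h x)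
  rcases hcon _ hcenter hi with h0 | h1
  · exfalso
    have h2 : F.blockEnd O = 0 := by
      ext
      exact h0
    have h3 := proj_comp_blockEnd O a
    rw [h2, if_pos haO, LinearMap.comp_zero] at h3
    refine hne a ?_
    rw [← F.proj_inc_self a, ← h3, LinearMap.zero_comp]
  · have h2 : F.blockEnd O = LinearMap.id := by
      ext
      exact h1
    by_contra hk
    have hbO : F.cl b ∉ O := by
      rw [hb]
      exact hk
    have h3 := proj_comp_blockEnd O b
    rw [h2, if_neg hbO, LinearMap.comp_id] at h3
    refine hne b ?_
    rw [← F.proj_inc_self b, h3, LinearMap.zero_comp]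

end Transitive

theorem exists_vertex_of_core {X : ModuleCat.{u} Λ} (F : SerialFrame Λ) (hX : core Λ X)
    [Nontrivial X] : ∃ i, F.IsGorensteinVertex i := by
  obtain ⟨n, Y, hY, ⟨e⟩⟩ := hX
  have hn : 0 < n := by
    rcases Nat.eq_zero_or_pos n with rfl | hn
    · have := (DirectSum.linearEquivFunOnFintype Λ (Fin 0) fun i => Y i).toEquiv.subsingleton
      have := e.toEquiv.subsingleton
      exact (not_subsingleton X this).elim
    · exact hn
  rcases hY ⟨0, hn⟩ with h | ⟨N, h, -⟩
  all_goals
    obtain ⟨i, l, -, hg⟩ := (gpIndec_iff (F := F) _).1 h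
    exact ⟨i, hg.vertex⟩

theorem exists_systemOfRepresentatives (F : SerialFrame Λ) :
    ∃ (g : ℕ) (E : Fin g → ModuleCat.{u} Λ), IsSystemOfRepresentatives (elementary Λ) E := by
  obtain ⟨g, ⟨e⟩⟩ := Finite.exists_equiv_fin {i : F.I // F.IsGorensteinVertex i}
  have hex : ∀ k : Fin g, ∃ (X : ModuleCat.{u} Λ) (l : ℕ), F.IsU X (e.symm k).1 l ∧
      F.IsElementaryType (e.symm k).1 l := by
    intro k
    obtain ⟨m, hm⟩ := (e.symm k).2.exists_isElementaryType
    obtain ⟨X, hX⟩ := F.exists_isU_of_le_c _ hm.pos hm.lt_c.le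
    exact ⟨X, m, hX, hm⟩
  choose E l hU hE using hex
  refine ⟨g, E, fun k => (elementary_iff _).2 ⟨_, _, hU k, hE k⟩, fun k k' ⟨f⟩ => ?_,
    fun M hM => ?_⟩
  · exact e.symm.injective (Subtype.ext (((hU k).of_equiv f).index_unique (hU k')))
  · obtain ⟨i, m, hM, hm⟩ := (elementary_iff (F := F) _).1 hM
    have h1 := hU (e ⟨i, hm.vertex⟩)
    have h2 := hE (e ⟨i, hm.vertex⟩)
    rw [Equiv.symm_apply_apply] at h1 h2
    rw [← hm.unique h2] at h1
    exact ⟨_, hM.nonempty_equiv h1⟩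

/-- A non-zero map between elementary modules is bijective. -/
theorem IsElementaryType.bijective {N : Type u} [AddCommGroup N] [Module Λ N]
    (hi : F.IsElementaryType i l) (hj : F.IsElementaryType j m) (hM : F.IsU M i l)
    (hN : F.IsU N j m) {f : M →ₗ[Λ] N} (hf : f ≠ 0) : i = j ∧ Function.Bijective f := by
  have := hM.finite
  have := hN.finite
  obtain ⟨h1, h2, h3, h4⟩ := hM.of_map hN hf
  -- A proper image would have its top, the vertex `i`, strictly inside the segment of `N`.
  have h5 : len Λ (LinearMap.range f) = m := by
    by_contra hne
    refine hj.not_vertex (m - len Λ (LinearMap.range f)) (by omega) (by omega) ?_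
    rw [h1]
    exact hi.vertex
  rw [h5, Nat.sub_self, Function.iterate_zero_apply] at h1
  subst h1
  refine ⟨rfl, ?_⟩
  have hs : Function.Surjective f :=
    LinearMap.range_eq_top.1 (eq_top_of_len (by rw [h5, hN.len_eq]))
  exact bijective_of_surjective_of_len hs (by rw [hM.len_eq, hN.len_eq, hi.unique hj])

open Classical in
/-- Every index lies in exactly one of the segments `i, tau i, …, tau^(l - 1) i` which belong to
the elementary modules. -/
theorem sum_card_eq_one {g : ℕ} {a : Fin g → F.I} {l : Fin g → ℕ}
    (hE : ∀ n, F.IsElementaryType (a n) (l n)) (hinj : Function.Injective a)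
    (hsurj : ∀ i, F.IsGorensteinVertex i → ∃ n, a n = i) {k : F.I}
    (hk : ∃ i, F.IsGorensteinVertex i ∧ ∃ r, F.tau^[r] i = k) :
    ∑ n, ((Finset.range (l n)).filter fun r => F.tau^[r] (a n) = k).card = 1 := by
  rw [← Finset.card_sigma, Finset.card_eq_one]
  -- The minimal `r` singles out the nearest vertex before `k`; a larger distance than the segment
  -- length would pass a closer vertex.
  have hex : ∃ r, ∃ i, F.IsGorensteinVertex i ∧ F.tau^[r] i = k := by
    obtain ⟨i, hi, r, hr⟩ := hk
    exact ⟨r, i, hi, hr⟩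
  obtain ⟨i, hi, hr⟩ := Nat.find_spec hex
  obtain ⟨n, rfl⟩ := hsurj i hi
  have hlt : Nat.find hex < l n := by
    by_contra hle
    push Not at hle
    refine Nat.find_min hex (m := Nat.find hex - l n) ?_ ⟨_, (hE n).vertex_iterate, ?_⟩
    · have := (hE n).pos
      omega
    · rw [← Function.iterate_add_apply, Nat.sub_add_cancel hle, hr]
  -- If two segments meet at `k`, cancelling `tau^r` puts the start of one inside the other, so the
  -- starts coincide.
  have huniq : ∀ (n n' : Fin g) (r r' : ℕ), r ≤ r' → r' < l n' → F.tau^[r] (a n) = k →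
      F.tau^[r'] (a n') = k → n = n' ∧ r = r' := by
    intro n n' r r' hle hr' h h'
    have h1 : a n = F.tau^[r' - r] (a n') := by
      apply F.tau_injective.iterate r
      rw [← Function.iterate_add_apply, Nat.add_sub_cancel' hle, h, h']
    have h2 : r' - r = 0 := by
      by_contra hne
      refine (hE n').not_vertex (r' - r) (by omega) (by omega) ?_
      rw [← h1]
      exact (hE n).vertex
    rw [h2] at h1
    exact ⟨hinj h1, by omega⟩
  refine ⟨⟨n, Nat.find hex⟩, Finset.eq_singleton_iff_unique_mem.2 ⟨?_, ?_⟩⟩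
  · simp only [Finset.mem_sigma, Finset.mem_univ, Finset.mem_filter, Finset.mem_range, true_and]
    exact ⟨hlt, hr⟩
  · rintro ⟨n', r'⟩ h
    simp only [Finset.mem_sigma, Finset.mem_univ, Finset.mem_filter, Finset.mem_range,
      true_and] at h
    obtain ⟨rfl, rfl⟩ := huniq n n' _ r' (Nat.find_min' hex ⟨_, (hE n').vertex, h.2⟩) h.1 hr h.2
    rfl

theorem hasMultiplicity_one {g : ℕ} {E : Fin g → ModuleCat.{u} Λ} {a : Fin g → F.I}
    {l : Fin g → ℕ} (hU : ∀ n, F.IsU (E n) (a n) (l n))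
    (hE : ∀ n, F.IsElementaryType (a n) (l n)) (hinj : Function.Injective a)
    (hsurj : ∀ i, F.IsGorensteinVertex i → ∃ n, a n = i) (hS : F.IsU S k 1)
    (hk : ∃ i, F.IsGorensteinVertex i ∧ ∃ r, F.tau^[r] i = k) :
    HasMultiplicity Λ S (⨁ n, E n) 1 := by
  have h1 := (HasChain.pi E _ fun n => hS.hasChain (hU n)).of_equiv
    (DirectSum.linearEquivFunOnFintype Λ (Fin g) fun n => E n).symm
  rw [sum_card_eq_one hE hinj hsurj hk] at h1
  exact h1.exists_compositionSeries

end SerialFrame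

end NakayamaGP

/-! ### The main theorem. -/

theorem proposition2 (k : Type*) [CommRing k] [IsArtinianRing k]
    (Λ : Type u) [Ring Λ] [Algebra k Λ] [Module.Finite k Λ]
    (hΛ : NakayamaGP.IsNakayama Λ)
    (hsimple : ∀ (S : Type u) [AddCommGroup S] [Module Λ S],
      IsSimpleModule Λ S → ¬ Module.Projective Λ S) :
    (NakayamaGP.core Λ = NakayamaGP.filtered (NakayamaGP.elementary Λ)) ∧
    (NakayamaGP.IsConnectedRing Λ →
      (∃ M : ModuleCat.{u} Λ, NakayamaGP.core Λ M ∧ Nontrivial M) →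
      (∃ (g : ℕ) (E : Fin g → ModuleCat.{u} Λ),
        NakayamaGP.IsSystemOfRepresentatives (NakayamaGP.elementary Λ) E) ∧
      ∀ (g : ℕ) (E : Fin g → ModuleCat.{u} Λ),
        NakayamaGP.IsSystemOfRepresentatives (NakayamaGP.elementary Λ) E →
        (∀ (S : Type u) [AddCommGroup S] [Module Λ S], IsSimpleModule Λ S →
          NakayamaGP.HasMultiplicity Λ S (⨁ i, E i) 1) ∧
        (∀ i, NakayamaGP.IsBrick Λ (E i)) ∧
        (∀ i j, i ≠ j → ∀ f : E i →ₗ[Λ] E j, f = 0)) ∧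
    (NakayamaGP.elementary Λ = NakayamaGP.elementaryDual Λ) := by
  have : IsArtinianRing Λ := isArtinian_of_tower k inferInstance
  have : Module.Finite k Λᵐᵒᵖ := Module.Finite.equiv (MulOpposite.opLinearEquiv k)
  have : IsArtinianRing Λᵐᵒᵖ := isArtinian_of_tower k inferInstance
  obtain ⟨F⟩ := NakayamaGP.exists_serialFrame hΛ hsimple
  refine ⟨?_, fun hconn ⟨X, hX, _⟩ => ⟨F.exists_systemOfRepresentatives, fun g E hE => ?_⟩, ?_⟩
  · ext X
    exact ⟨NakayamaGP.SerialFrame.filtered_of_core F, NakayamaGP.SerialFrame.core_of_filtered F⟩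
  · obtain ⟨h1, h2, h3⟩ := hE
    choose a l hU hel using fun n => (NakayamaGP.SerialFrame.elementary_iff (F := F) _).1 (h1 n)
    have hinj : Function.Injective a := by
      intro n n' h
      refine h2 n n' ?_
      have hel' := hel n'
      have hU' := hU n'
      rw [← h] at hel' hU'
      rw [← (hel n).unique hel'] at hU'
      exact (hU n).nonempty_equiv hU'
    have hsurj : ∀ i, F.IsGorensteinVertex i → ∃ n, a n = i := by
      intro i hi
      obtain ⟨m, hm⟩ := hi.exists_isElementaryType
      obtain ⟨Y, hY⟩ := F.exists_isU_of_le_c _ hm.pos hm.lt_c.le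
      obtain ⟨n, ⟨e⟩⟩ := h3 Y ((NakayamaGP.SerialFrame.elementary_iff _).2 ⟨i, m, hY, hm⟩)
      exact ⟨n, (hU n).index_unique (hY.of_equiv e)⟩
    obtain ⟨v, hv⟩ := NakayamaGP.SerialFrame.exists_vertex_of_core F hX
    refine ⟨fun S _ _ hS => ?_, fun n => ⟨(hU n).nontrivial, fun f hf => ?_⟩, fun n n' hn f => ?_⟩
    · obtain ⟨j, hj⟩ := NakayamaGP.SerialFrame.exists_isU_of_simple (F := F) (M := S)
      exact NakayamaGP.SerialFrame.hasMultiplicity_one hU hel hinj hsurj hj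
        ⟨v, hv, F.exists_iterate_eq hconn v j⟩
    · exact ((hel n).bijective (hel n) (hU n) (hU n) hf).2
    · by_contra hf
      exact hn (hinj ((hel n).bijective (hel n') (hU n) (hU n') hf).1)
  · ext X
    rw [NakayamaGP.SerialFrame.elementary_iff (F := F),
      NakayamaGP.SerialFrame.elementaryDual_iff (F := F)]
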